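/- A finite hypergraph $\mathcal G=(V,E)$ has a nonempty finite vertex set $V$ and a set $E$ of edges, each a subset of $V$ with at least two elements; it is $k$-uniform if every edge has exactly $k$ vertices, and its order is $|V|$. Its adjacency matrix $\mathcal A_{\mathcal G}$ has the entries $(\mathcal A_{\mathcal G})_{ij}=\sum_{e\in E,\ i,j\in e}\frac{1}{|e|-1}$ for $i\ne j$ and zero diagonal, and $\rho(\mathcal G)$ denotes the largest modulus of an eigenvalue of $\mathcal A_{\mathcal G}$. Isomorphism $\cong$ is a bijection of the vertex sets that carries the edge set onto the edge set. A hypercycle of length $q\ge 2$ consists of distinct vertices $x_1,\dots,x_q$ and distinct edges $f_1,\dots,f_q$ with $x_i,x_{i+1}\in f_i$ (indices modulo $q$) such that, if $q\ge 3$, $f_i\cap f_{i+1}=\{x_{i+1}\}$ and edges that are not cyclically consecutive are disjoint; for $q=2$ it is just a pair of distinct edges with at least two common vertices. A supertree is a connected hypergraph that contains no hypercycle (a single vertex is allowed). Let $k\ge 3$ and $g\ge 2$. Let $\mathcal C_g$ be the $k$-uniform $g$-hypercycle with the edges $e_i=\{v_i,v_{a(i,1)},\dots,v_{a(i,k-2)},v_{i+1}\}$,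 $1\le i\le g$, where $v_{g+1}=v_1$ and all the vertices $v_i$, $v_{a(i,j)}$ are distinct. Attaching a hypergraph $T$ with a chosen vertex $r$ at a vertex $c$ of $\mathcal C_g$ means taking disjoint copies of $\mathcal C_g$ and $T$ and identifying $c$ with $r$. For $s\ge 0$, the $k$-uniform hyperpath of length $s$ has the vertices $0,1,\dots,s(k-1)$ and the edges $\{i(k-1),i(k-1)+1,\dots,(i+1)(k-1)\}$, $0\le i<s$, and $\mathrm{Lop}_{g,k,s;1}$ and $\mathrm{Lop}_{g,k,s;2}$ are obtained by attaching this hyperpath, with its end vertex $0$, at $v_1$ and at $v_{a(1,1)}$ respectively. Let $\mathcal G$ be a hypergraph of order $n$. (1) If $\mathcal G$ is isomorphic to a hypergraph obtained by attaching some finite $k$-uniform supertree, with any of its vertices, at some vertex of $\mathcal C_g$, then $s=\frac{n}{k-1}-g$ is a nonnegative integer and $\rho(\mathrm{Lop}_{g,k,s;2})\le\rho(\mathcal G)$, with equality if and only if $\mathcal G\cong \mathrm{Lop}_{g,k,s;2}$. (2) If $\mathcal G$ is isomorphic to a hypergraph obtained by attaching some finite $k$-uniform supertree, with any of its vertices,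 at the vertex $v_1$ of $\mathcal C_g$, then $s=\frac{n}{k-1}-g$ is a nonnegative integer and $\rho(\mathrm{Lop}_{g,k,s;1})\le\rho(\mathcal G)$, with equality if and only if $\mathcal G\cong \mathrm{Lop}_{g,k,s;1}$. (3) If $\mathcal G$ is isomorphic to a hypergraph obtained by attaching some finite $k$-uniform supertree, with any of its vertices, at the vertex $v_{a(1,1)}$ of $\mathcal C_g$, then $s=\frac{n}{k-1}-g$ is a nonnegative integer and $\rho(\mathrm{Lop}_{g,k,s;2})\le\rho(\mathcal G)$, with equality if and only if $\mathcal G\cong \mathrm{Lop}_{g,k,s;2}$. -/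

import Mathlib

/-- A hypergraph whose vertex set is the whole type `V` and each of whose edges contains at least
two vertices.  The edges form a set, so no edge is repeated. -/
structure SimpleHypergraph (V : Type*) extends Hypergraph V where
  vertexSet_eq_univ : vertexSet = Set.univ
  two_le_ncard : ∀ e ∈ edgeSet, 2 ≤ e.ncard

/-- The cyclic successor `i ↦ i + 1 (mod q)` on `{0, …, q - 1}`. -/
def cyclicSucc {q : ℕ} (i : Fin q) : Fin q :=
  ⟨(i.val + 1) % q, Nat.mod_lt _ (Nat.lt_of_le_of_lt (Nat.zero_le _) i.isLt)⟩

namespace SimpleHypergraph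

universe u v

variable {V : Type u} {W : Type v}

/-- Every edge has exactly `k` vertices. -/
def IsUniform (H : SimpleHypergraph V) (k : ℕ) : Prop :=
  ∀ e ∈ H.edgeSet, e.ncard = k

/-- `H` is connected: it has a vertex, and any two vertices are joined by a chain of vertices in
which consecutive ones lie in a common edge. -/
def Connected (H : SimpleHypergraph V) : Prop :=
  (SimpleGraph.fromRel H.toHypergraph.Adj).Connected

/-- The alternating sequence `v₀ e₀ v₁ e₁ ⋯ v_{q-1} e_{q-1} v₀` is a hypercycle of length `q` of
`H`: the vertices are distinct, the edges are distinct, `vᵢ, vᵢ₊₁ ∈ eᵢ`, edges that are not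
cyclically consecutive are disjoint, and, if `q ≥ 3`, then `eᵢ ∩ eᵢ₊₁ = {vᵢ₊₁}`.  For `q = 2` this
says that `e₀` and `e₁` are two different edges with at least two common vertices. -/
def IsHypercycle (H : SimpleHypergraph V) (q : ℕ) (x : Fin q → V) (e : Fin q → Set V) : Prop :=
  2 ≤ q ∧ Function.Injective x ∧ Function.Injective e ∧
    (∀ i, e i ∈ H.edgeSet) ∧
    (∀ i, x i ∈ e i ∧ x (cyclicSucc i) ∈ e i) ∧
    (3 ≤ q → ∀ i, e i ∩ e (cyclicSucc i) = {x (cyclicSucc i)}) ∧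
    (∀ i j, i ≠ j → j ≠ cyclicSucc i → i ≠ cyclicSucc j → Disjoint (e i) (e j))

/-- `H` contains no hypercycle. -/
def Acyclic (H : SimpleHypergraph V) : Prop :=
  ∀ (q : ℕ) (x : Fin q → V) (e : Fin q → Set V), ¬ H.IsHypercycle q x e

/-- A supertree is a connected acyclic hypergraph. -/
def IsSupertree (H : SimpleHypergraph V) : Prop :=
  H.Connected ∧ H.Acyclic

/-- An isomorphism of hypergraphs: a bijection of the vertices that maps edges to edges, in both
directions. -/
structure Iso (G : SimpleHypergraph V) (H : SimpleHypergraph W) extends V ≃ W where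
  image_mem_edgeSet_iff : ∀ e : Set V, toEquiv '' e ∈ H.edgeSet ↔ e ∈ G.edgeSet

open Classical in
/-- The adjacency matrix: the entry at `i ≠ j` is the sum of `1 / (|e| - 1)` over all edges `e`
that contain both `i` and `j`; the diagonal entries are `0`. -/
noncomputable def adjMatrix [Fintype V] (H : SimpleHypergraph V) : Matrix V V ℝ :=
  Matrix.of fun i j =>
    if i = j then 0
    else ∑ e : Set V with e ∈ H.edgeSet ∧ i ∈ e ∧ j ∈ e, 1 / ((e.ncard : ℝ) - 1)

theorem adjMatrix_isSymm [Fintype V] (H : SimpleHypergraph V) : H.adjMatrix.IsSymm := by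
  classical
  ext i j
  simp only [adjMatrix, Matrix.transpose_apply, Matrix.of_apply, eq_comm (a := j) (b := i),
    and_comm (a := j ∈ _) (b := i ∈ _)]

open Classical in
/-- The spectral radius of `H`: the largest modulus of an eigenvalue of the adjacency matrix.  The
matrix is real and symmetric, so that all its eigenvalues are real. -/
noncomputable def rho [Fintype V] (H : SimpleHypergraph V) : ℝ :=
  (spectralRadius ℝ H.adjMatrix).toReal

/-- The vertices of the hypergraph obtained from hypergraphs on `V` and `W` by identifying a vertex
of the first with the vertex `r` of the second. -/
abbrev Glued (V : Type u) (W : Type v) (r : W) : Type (max u v) := V ⊕ {w : W // w ≠ r}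

open Classical in
/-- The inclusion of the second vertex set into the glued one: `r` is sent to the vertex `c` of the
first hypergraph. -/
noncomputable def gluedInr (c : V) (r : W) (w : W) : Glued V W r :=
  if h : w = r then Sum.inl c else Sum.inr ⟨w, h⟩

theorem gluedInr_injective (c : V) (r : W) : Function.Injective (gluedInr c r) := by
  intro a b hab
  unfold gluedInr at hab
  split_ifs at hab with ha hb hb
  · rw [ha, hb]
  · simpa using hab

/-- The hypergraph obtained by attaching `T` to `C`: the disjoint union of `C` and `T`, in which the
vertex `c` of `C` and the vertex `r` of `T` are identified. -/
noncomputable def attach (C : SimpleHypergraph V) (c : V) (T : SimpleHypergraph W) (r : W) :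
    SimpleHypergraph (Glued V W r) where
  vertexSet := Set.univ
  edgeSet := (fun e : Set V => Sum.inl '' e) '' C.edgeSet ∪
    (fun e : Set W => gluedInr c r '' e) '' T.edgeSet
  subset_vertexSet_of_mem_edgeSet' := fun _ _ => Set.subset_univ _
  vertexSet_eq_univ := rfl
  two_le_ncard := by
    rintro _ (⟨e, he, rfl⟩ | ⟨e, he, rfl⟩)
    · simpa [Set.ncard_image_of_injective _ Sum.inl_injective] using C.two_le_ncard e he
    · simpa [Set.ncard_image_of_injective _ (gluedInr_injective c r)] using T.two_le_ncard e he

/-- The `k`-uniform `g`-hypercycle.  The vertex `(i, 0)` is the `i`-th of the `g` vertices in which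
consecutive edges meet, and the `i`-th edge consists of `(i, 0)`, of the `k - 2` vertices `(i, j)`
with `1 ≤ j ≤ k - 2`, which lie in no other edge, and of `(i + 1, 0)`, where `i + 1` is taken
modulo `g`. -/
def hypercycle (g : ℕ) {k : ℕ} (hk : 3 ≤ k) : SimpleHypergraph (Fin g × Fin (k - 1)) where
  vertexSet := Set.univ
  edgeSet := Set.range fun i : Fin g =>
    {p : Fin g × Fin (k - 1) | p.1 = i ∨ (p.1 = cyclicSucc i ∧ p.2.val = 0)}
  subset_vertexSet_of_mem_edgeSet' := fun _ _ => Set.subset_univ _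
  vertexSet_eq_univ := rfl
  two_le_ncard := by
    rintro _ ⟨i, rfl⟩
    refine (Set.one_lt_ncard (Set.toFinite _)).2
      ⟨(i, ⟨0, by omega⟩), by simp, (i, ⟨1, by omega⟩), by simp, by simp⟩

/-- The vertex of degree two of the hypercycle at which its first edge starts. -/
def cycleVertex {g k : ℕ} (hk : 3 ≤ k) (hg : 2 ≤ g) : Fin g × Fin (k - 1) :=
  (⟨0, by omega⟩, ⟨0, by omega⟩)

/-- A vertex of degree one in the first edge of the hypercycle. -/
def cycleInnerVertex {g k : ℕ} (hk : 3 ≤ k) (hg : 2 ≤ g) : Fin g × Fin (k - 1) :=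
  (⟨0, by omega⟩, ⟨1, by omega⟩)

/-- The `k`-uniform hyperpath of length `s`.  The `i`-th edge consists of the `k` consecutive
vertices `i (k - 1), …, (i + 1) (k - 1)`. -/
def hyperpath {k : ℕ} (hk : 3 ≤ k) (s : ℕ) : SimpleHypergraph (Fin (s * (k - 1) + 1)) where
  vertexSet := Set.univ
  edgeSet := Set.range fun i : Fin s =>
    {w : Fin (s * (k - 1) + 1) | i.val * (k - 1) ≤ w.val ∧ w.val ≤ (i.val + 1) * (k - 1)}
  subset_vertexSet_of_mem_edgeSet' := fun _ _ => Set.subset_univ _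
  vertexSet_eq_univ := rfl
  two_le_ncard := by
    rintro _ ⟨i, rfl⟩
    have h1 : (i.val + 1) * (k - 1) ≤ s * (k - 1) := Nat.mul_le_mul_right _ i.isLt
    have h2 : (i.val + 1) * (k - 1) = i.val * (k - 1) + (k - 1) := Nat.succ_mul _ _
    refine (Set.one_lt_ncard (Set.toFinite _)).2
      ⟨⟨i.val * (k - 1), by omega⟩, ?_, ⟨(i.val + 1) * (k - 1), by omega⟩, ?_, ?_⟩
    · exact ⟨le_refl _, by simp only; omega⟩
    · exact ⟨by simp only; omega, le_refl _⟩
    · simp only [ne_eq, Fin.mk.injEq]; omega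

/-- The lollipop of the first type: a pendant hyperpath of length `s`, attached by its end vertex at
a vertex of degree two of the `g`-hypercycle. -/
noncomputable def lollipop₁ {g k : ℕ} (hk : 3 ≤ k) (hg : 2 ≤ g) (s : ℕ) :
    SimpleHypergraph (Glued (Fin g × Fin (k - 1)) (Fin (s * (k - 1) + 1)) 0) :=
  attach (hypercycle g hk) (cycleVertex hk hg) (hyperpath hk s) 0

/-- The lollipop of the second type: a pendant hyperpath of length `s`, attached by its end vertex
at a vertex of degree one of the `g`-hypercycle. -/
noncomputable def lollipop₂ {g k : ℕ} (hk : 3 ≤ k) (hg : 2 ≤ g) (s : ℕ) :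
    SimpleHypergraph (Glued (Fin g × Fin (k - 1)) (Fin (s * (k - 1) + 1)) 0) :=
  attach (hypercycle g hk) (cycleInnerVertex hk hg) (hyperpath hk s) 0

/-- `G` is (up to isomorphism) obtained from the `k`-uniform `g`-hypercycle by attaching some finite
`k`-uniform supertree at the vertex `c` of the hypercycle. -/
def IsOctopuslikeAt (G : SimpleHypergraph V) {g k : ℕ} (hk : 3 ≤ k)
    (c : Fin g × Fin (k - 1)) : Prop :=
  ∃ (W : Type) (_ : Finite W) (T : SimpleHypergraph W) (r : W),
    T.IsUniform k ∧ T.IsSupertree ∧ Nonempty (G.Iso (attach (hypercycle g hk) c T r))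

/-- `G` is octopuslike: obtained from the `k`-uniform `g`-hypercycle by attaching a finite
`k`-uniform supertree at some vertex of the hypercycle. -/
def IsOctopuslike (G : SimpleHypergraph V) {k : ℕ} (hk : 3 ≤ k) (g : ℕ) : Prop :=
  ∃ c : Fin g × Fin (k - 1), G.IsOctopuslikeAt hk c

end SimpleHypergraph

/-! Put m = k - 1. Fix the vertex c of the hypercycle at which a supertree `T` with s edges is
attached, and let x be the positive eigenvector of the hypercycle with a hyperpath of length s
attached at c, with ρ its spectral radius and Λ = mρ. By the Rayleigh principle, the spectral radius
is at least ρ as soon as the hypergraph carrying `T` has a positive vector Y with m A Y ≥ Λ Y; if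
the two radii are equal, Y satisfies the eigenvalue equations. Y is taken equal to x on the
hypercycle, so the task is local: `T` needs a positive vector with value 1 at its root that
satisfies the inequality off the root and whose edge sum at the root is at least that of the
hyperpath.

The edge sum of a hyperpath of length t at its root, relative to the value there, is its response
α(t). Solving the equations along a pendant edge turns branch lengths p into the numbers 1/(D -
α(p)), where D = Λ + 1. Explicitly, α is a ratio of consecutive terms of a two-term linear
recurrence, and a constant Casoratian makes both α and 1/(D - α) - 1/D strictly concave, hence
strictly subadditive (`exists_isResponse`). So merging several branches into one of the same total
length never increases the response, and strictly decreases it when at least two branches have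
positive length. Induction over a hypertree grown edge by edge (`IsHypertreeOn.exists_subinvariant`)
yields the local vector, and equality forces a hyperpath rooted at its end. The recurrence must not
oscillate; this is a lower bound for Λ, obtained by testing against the symmetric vector of the
hypercycle (`hypercycle_bounds`).

For an arbitrary c, an automorphism of the hypercycle leaves only two positions. Every edge at the
inner vertex also contains the cut vertex, but not conversely, so `rho_attach_lt_rho_attach` shows
that the inner position gives the smaller radius once s ≥ 1. -/

open scoped Matrix

/-! ### Rayleigh principle for real symmetric matrices. -/

section Spectral

variable {n : Type*} [Fintype n] [DecidableEq n]

theorem Matrix.toReal_spectralRadius_spec [Nonempty n] {A : Matrix n n ℝ} (hA : A.IsSymm) :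
    (∀ μ ∈ spectrum ℝ A, |μ| ≤ (spectralRadius ℝ A).toReal) ∧
      ∃ μ ∈ spectrum ℝ A, |μ| = (spectralRadius ℝ A).toReal := by
  have hH : A.IsHermitian := by
    rw [Matrix.IsHermitian, Matrix.conjTranspose_eq_transpose_of_trivial]; exact hA
  have hfin : (spectrum ℝ A).Finite := by
    rw [hH.spectrum_real_eq_range_eigenvalues]; exact Set.finite_range _
  have hne : (spectrum ℝ A).Nonempty := by
    rw [hH.spectrum_real_eq_range_eigenvalues]; exact Set.range_nonempty _
  obtain ⟨μ, hμ, hmax⟩ := Set.exists_max_image _ (fun x : ℝ => ‖x‖₊) hfin hne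
  have h : spectralRadius ℝ A = (‖μ‖₊ : ENNReal) := by
    refine le_antisymm (iSup₂_le fun ν hν => ?_) (le_iSup₂ (f := fun (k : ℝ) (_ : k ∈ spectrum ℝ A) => (‖k‖₊ : ENNReal)) μ hμ)
    exact_mod_cast hmax ν hν
  have h2 : (spectralRadius ℝ A).toReal = |μ| := by
    rw [h]; simp
  rw [h2]
  refine ⟨fun ν hν => ?_, μ, hμ, rfl⟩
  have := hmax ν hν
  rw [← NNReal.coe_le_coe] at this
  simpa using this

theorem Matrix.posSemidef_spectralRadius_sub [Nonempty n] {A : Matrix n n ℝ} (hA : A.IsSymm) :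
    (Matrix.scalar n (spectralRadius ℝ A).toReal - A).PosSemidef := by
  have hH : A.IsHermitian := by
    rw [Matrix.IsHermitian, Matrix.conjTranspose_eq_transpose_of_trivial]; exact hA
  rw [Matrix.posSemidef_iff_isHermitian_and_spectrum_nonneg]
  constructor
  · refine Matrix.IsHermitian.sub ?_ hH
    simp [Matrix.IsHermitian]
  · intro x hx
    have h1 : Matrix.scalar n (spectralRadius ℝ A).toReal =
      algebraMap ℝ (Matrix n n ℝ) (spectralRadius ℝ A).toReal := rfl
    rw [h1, ← spectrum.singleton_sub_eq] at hx
    obtain ⟨a, ha, b, hb, rfl⟩ := hx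
    rw [Set.mem_singleton_iff] at ha
    subst ha
    have := (Matrix.toReal_spectralRadius_spec hA).1 b hb
    simp only [Set.mem_ofPred_eq]
    have := le_abs_self b
    linarith

theorem Matrix.dotProduct_mulVec_le_spectralRadius [Nonempty n] {A : Matrix n n ℝ}
    (hA : A.IsSymm) (y : n → ℝ) :
    y ⬝ᵥ (A *ᵥ y) ≤ (spectralRadius ℝ A).toReal * (y ⬝ᵥ y) := by
  have := (Matrix.posSemidef_spectralRadius_sub hA).dotProduct_mulVec_nonneg y
  simp only [star_trivial, Matrix.sub_mulVec, dotProduct_sub] at this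
  simp only [Matrix.scalar_apply, ← Matrix.smul_one_eq_diagonal, Matrix.smul_mulVec,
    Matrix.one_mulVec, dotProduct_smul, smul_eq_mul] at this
  linarith

/-- A positive semidefinite form vanishes only on the kernel of its matrix. All later equality cases
rest on this. -/
theorem Matrix.mulVec_eq_of_spectralRadius_le [Nonempty n] {A : Matrix n n ℝ}
    (hA : A.IsSymm) (y : n → ℝ)
    (h : (spectralRadius ℝ A).toReal * (y ⬝ᵥ y) ≤ y ⬝ᵥ (A *ᵥ y)) :
    A *ᵥ y = (spectralRadius ℝ A).toReal • y := by
  have h1 := (Matrix.posSemidef_spectralRadius_sub hA).dotProduct_mulVec_zero_iff y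
  have h2 := Matrix.dotProduct_mulVec_le_spectralRadius hA y
  simp only [star_trivial, Matrix.sub_mulVec, dotProduct_sub] at h1
  simp only [Matrix.scalar_apply, ← Matrix.smul_one_eq_diagonal, Matrix.smul_mulVec,
    Matrix.one_mulVec, dotProduct_smul, smul_eq_mul] at h1
  exact (sub_eq_zero.1 (h1.1 (by linarith))).symm

/-- A symmetric matrix with nonnegative entries has a nonnegative eigenvector for its spectral
radius. -/
theorem Matrix.exists_nonneg_eigenvector [Nonempty n] {A : Matrix n n ℝ} (hA : A.IsSymm)
    (hnn : ∀ i j, 0 ≤ A i j) :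
    ∃ x : n → ℝ, (∀ i, 0 ≤ x i) ∧ x ≠ 0 ∧ A *ᵥ x = (spectralRadius ℝ A).toReal • x := by
  obtain ⟨μ, hμ, hρ⟩ := (Matrix.toReal_spectralRadius_spec hA).2
  rw [← Matrix.spectrum_toLin', ← Module.End.hasEigenvalue_iff_mem_spectrum] at hμ
  obtain ⟨v, hv⟩ := hμ.exists_hasEigenvector
  have hv1 : A *ᵥ v = μ • v := by simpa using hv.apply_eq_smul
  refine ⟨fun i => |v i|, fun i => abs_nonneg _, fun h => hv.2 ?_, ?_⟩
  · ext i; simpa using congrFun h i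
  -- For nonnegative A, replacing v by |v| does not lower the Rayleigh quotient below |μ|, so |v|
  -- attains the maximum.
  · apply Matrix.mulVec_eq_of_spectralRadius_le hA
    rw [← hρ]
    have h1 : |μ| * ((fun i => |v i|) ⬝ᵥ (fun i => |v i|)) = |v ⬝ᵥ (A *ᵥ v)| := by
      rw [hv1, dotProduct_smul, smul_eq_mul, abs_mul]
      congr 1
      simp only [dotProduct, abs_mul_abs_self]
      rw [abs_of_nonneg]
      exact Finset.sum_nonneg fun i _ => mul_self_nonneg _
    rw [h1]
    simp only [dotProduct, Matrix.mulVec]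
    refine (Finset.abs_sum_le_sum_abs _ _).trans (Finset.sum_le_sum fun i _ => ?_)
    rw [abs_mul]
    refine mul_le_mul_of_nonneg_left ?_ (abs_nonneg _)
    refine (Finset.abs_sum_le_sum_abs _ _).trans (Finset.sum_le_sum fun j _ => ?_)
    rw [abs_mul, abs_of_nonneg (hnn i j)]

/-- A positive vector `y` with `A y ≥ c y` bounds the spectral radius from below, and equality holds
only if `y` is an eigenvector. -/
theorem Matrix.le_spectralRadius_of_subinvariant [Nonempty n] {A : Matrix n n ℝ} (hA : A.IsSymm)
    {y : n → ℝ} (hy : ∀ i, 0 < y i) {c : ℝ} (h : ∀ i, c * y i ≤ (A *ᵥ y) i) :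
    c ≤ (spectralRadius ℝ A).toReal ∧
      (c = (spectralRadius ℝ A).toReal → ∀ i, (A *ᵥ y) i = c * y i) := by
  have h0 : 0 < y ⬝ᵥ y := Finset.sum_pos (fun i _ => mul_pos (hy i) (hy i)) Finset.univ_nonempty
  have h1 : c * (y ⬝ᵥ y) ≤ y ⬝ᵥ (A *ᵥ y) := by
    simp only [dotProduct, Finset.mul_sum]
    refine Finset.sum_le_sum fun i _ => ?_
    have := mul_le_mul_of_nonneg_left (h i) (hy i).le
    linarith
  have h2 := Matrix.dotProduct_mulVec_le_spectralRadius hA y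
  refine ⟨le_of_mul_le_mul_right (h1.trans h2) h0, fun hc i => ?_⟩
  have := Matrix.mulVec_eq_of_spectralRadius_le hA y (by rw [← hc]; exact h1)
  rw [this, hc]; simp

end Spectral

/-! ### The response of a pendant hyperpath. -/

/-- The laws of the sequence `α`, where `α t` is the response of a pendant hyperpath of length `t`
at its root, for uniformity `m + 1` and `D = m λ + 1`. -/
structure IsResponse (m : ℕ) (D : ℝ) (α : ℕ → ℝ) : Prop where
  zero : α 0 = 0
  pos_denom : ∀ t, 0 < D - α t
  nonneg : ∀ t, 0 ≤ α t
  add_lt : ∀ p q, 1 ≤ p → 1 ≤ q → α (p + q) < α p + α q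
  inv_add_lt : ∀ p q, 1 ≤ p → 1 ≤ q →
    (D - α (p + q))⁻¹ + D⁻¹ < (D - α p)⁻¹ + (D - α q)⁻¹
  succ : ∀ t, (1 + α (t + 1)) * (1 - ((D - α t)⁻¹ + (m - 1) * D⁻¹)) = 1

/-- The values of an eigenvector at the cut vertices of a hyperpath, counted from the free end. -/
noncomputable def pathSeq (τ z₁ : ℝ) : ℕ → ℝ
  | 0 => 1
  | 1 => z₁
  | t + 2 => τ * pathSeq τ z₁ (t + 1) - pathSeq τ z₁ t

theorem pathSeq_pos_and_lt {τ z₁ : ℝ} (hτ : 2 ≤ τ) (hz : 1 < z₁) (t : ℕ) :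
    0 < pathSeq τ z₁ t ∧ pathSeq τ z₁ t < pathSeq τ z₁ (t + 1) := by
  induction t with
  | zero => simp [pathSeq, hz]
  | succ t ih =>
    refine ⟨ih.1.trans ih.2, ?_⟩
    have h : pathSeq τ z₁ (t + 1 + 1) = τ * pathSeq τ z₁ (t + 1) - pathSeq τ z₁ t := rfl
    rw [h]
    nlinarith [ih.1, ih.2]

/-- The recurrence has constant term coefficient -1, which makes this determinant independent of t.
It is the common numerator of the increments of `α` and of `(D - α)⁻¹`. -/
theorem pathSeq_casoratian (τ z₁ : ℝ) (t : ℕ) :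
    pathSeq τ z₁ (t + 1) ^ 2 - pathSeq τ z₁ t * pathSeq τ z₁ (t + 2) =
      z₁ ^ 2 - (τ * z₁ - 1) := by
  induction t with
  | zero => simp [pathSeq]
  | succ t ih =>
    rw [← ih]
    have h : ∀ t, pathSeq τ z₁ (t + 2) = τ * pathSeq τ z₁ (t + 1) - pathSeq τ z₁ t := fun _ => rfl
    rw [h (t + 1), h t]
    ring

/-- A sequence that starts at zero and is strictly concave is strictly subadditive. -/
theorem add_lt_of_strictConcave {f : ℕ → ℝ} (h0 : f 0 = 0)
    (hf : ∀ t, f (t + 2) - f (t + 1) < f (t + 1) - f t) {p q : ℕ} (hp : 1 ≤ p) (hq : 1 ≤ q) :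
    f (p + q) < f p + f q := by
  have key : ∀ p t, f (t + p + 1) - f (t + p) ≤ f (t + 1) - f t ∧
      (1 ≤ p → f (t + p + 1) - f (t + p) < f (t + 1) - f t) := by
    intro p t
    induction p with
    | zero => simp
    | succ p ih =>
      have := hf (t + p)
      have h1 := ih.1
      have h2 : t + (p + 1) + 1 = t + p + 2 := by ring
      have h3 : t + (p + 1) = t + p + 1 := by ring
      rw [h2, h3]
      exact ⟨by linarith, fun _ => by linarith⟩
  have main : ∀ q, 1 ≤ q → f (p + q) < f p + f q := by
    intro q hq
    induction q, hq using Nat.le_induction with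
    | base =>
      have := (key p 0).2 hp
      simp only [zero_add, h0] at this
      linarith
    | succ q hq ih =>
      have := (key p q).2 hp
      rw [show p + (q + 1) = q + p + 1 by ring]
      rw [show p + q = q + p by ring] at ih
      linarith
  exact main q hq

/-- The eigenvalue equations on a hyperpath reduce to a recurrence for the values z at its cut
vertices. The second bound on Λ says exactly that τ ≥ 2, so z is positive and increasing. The
increments of `α` and `(D - α)⁻¹` are then a fixed positive constant over an increasing product,
whence strict concavity. -/
theorem exists_isResponse {m : ℕ} (hm : 2 ≤ m) {Λ : ℝ} (h1 : (m : ℝ) < Λ)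
    (h2 : 4 * (Λ + 1) ≤ (Λ + 2) * (Λ - m + 2)) : ∃ α, IsResponse m (Λ + 1) α := by
  set D := Λ + 1 with hD
  -- An inner vertex of an edge with total S has value S / D. Eliminating the m - 1 inner vertices
  -- gives S = (D / F) (z t + z (t + 1)), with F = D - (m - 1).
  set F := Λ - m + 2 with hF
  have hm' : (2 : ℝ) ≤ m := by exact_mod_cast hm
  have hF2 : 2 < F := by simp only [hF]; linarith
  have hD0 : 0 < D := by simp only [hD]; linarith
  have hF0 : 0 < F := by linarith
  -- The equation at a cut vertex between two edges is (D + 1) z (t + 1) = (D / F) (z t + 2 z (t +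
  -- 1) + z (t + 2)). At the free end, D z 0 = (D / F) (z 0 + z 1), which gives z 1 = F - 1.
  set τ := (D + 1) * F / D - 2 with hτ
  have hτ2 : 2 ≤ τ := by
    rw [hτ, le_sub_iff_add_le, le_div_iff₀ hD0]; simp only [hD, hF] at *; linarith
  set z := pathSeq τ (F - 1) with hz
  have zpos : ∀ t, 0 < z t := fun t => (pathSeq_pos_and_lt hτ2 (by linarith) t).1
  have zlt : ∀ t, z t < z (t + 1) := fun t => (pathSeq_pos_and_lt hτ2 (by linarith) t).2
  have zrec : ∀ t, z (t + 2) = τ * z (t + 1) - z t := fun _ => rfl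
  have zcas : ∀ t, 0 < z (t + 1) ^ 2 - z t * z (t + 2) := by
    intro t
    rw [hz, pathSeq_casoratian]
    have : (F - 1) ^ 2 - (τ * (F - 1) - 1) = F * (m : ℝ) / D := by
      rw [hτ]; field_simp; simp only [hD, hF]; ring
    rw [this]
    positivity
  have hzz : ∀ t, z (t + 2) + z t = ((D + 1) * F / D - 2) * z (t + 1) := by
    intro t; rw [zrec, hτ]; ring
  have z0 : z 0 = 1 := rfl
  have z1 : z 1 = F - 1 := rfl
  -- `D - α t = (D / F) (1 + z (t + 1) / z t)`
  set α : ℕ → ℝ := fun t => D - D / F * (1 + z (t + 1) / z t) with hα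
  have hden : ∀ t, D - α t = D / F * (1 + z (t + 1) / z t) := fun t => by simp [hα]
  have hinv : ∀ t, (D - α t)⁻¹ = F / D * (z t / (z t + z (t + 1))) := by
    intro t
    have := zpos t; have := zpos (t + 1)
    rw [hden]; field_simp
  have hsuc : ∀ t, α (t + 1) = D / F * (1 + z t / z (t + 1)) - 1 := by
    intro t
    have := zpos (t + 1)
    simp only [hα]
    have h := hzz t
    field_simp at h ⊢
    linear_combination (-1 : ℝ) * h
  have α0 : α 0 = 0 := by
    simp only [hα, z0, zero_add, z1]; field_simp; ring
  have conc : ∀ t, α (t + 2) - α (t + 1) < α (t + 1) - α t := by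
    intro t
    have a0 := zpos t; have a1 := zpos (t + 1); have a2 := zpos (t + 2); have a3 := zpos (t + 3)
    have e1 : α (t + 2) - α (t + 1) =
        D / F * ((z (t + 2) ^ 2 - z (t + 1) * z (t + 3)) / (z (t + 1) * z (t + 2))) := by
      simp only [hα]; field_simp; ring
    have e2 : α (t + 1) - α t =
        D / F * ((z (t + 1) ^ 2 - z t * z (t + 2)) / (z t * z (t + 1))) := by
      simp only [hα]; field_simp; ring
    rw [e1, e2]
    have hc : z (t + 2) ^ 2 - z (t + 1) * z (t + 3) = z (t + 1) ^ 2 - z t * z (t + 2) := by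
      simp only [hz]; rw [pathSeq_casoratian, pathSeq_casoratian]
    rw [hc]
    refine mul_lt_mul_of_pos_left ?_ (by positivity)
    refine div_lt_div_of_pos_left (zcas t) (by positivity) ?_
    have := zlt t; have := zlt (t + 1); simp only [add_assoc] at *; norm_num at *
    nlinarith
  have conc' : ∀ t, ((D - α (t + 2))⁻¹ - D⁻¹) - ((D - α (t + 1))⁻¹ - D⁻¹) <
      ((D - α (t + 1))⁻¹ - D⁻¹) - ((D - α t)⁻¹ - D⁻¹) := by
    intro t
    have a0 := zpos t; have a1 := zpos (t + 1); have a2 := zpos (t + 2); have a3 := zpos (t + 3)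
    rw [hinv, hinv, hinv]
    have e1 : F / D * (z (t + 2) / (z (t + 2) + z (t + 2 + 1))) - D⁻¹ -
        (F / D * (z (t + 1) / (z (t + 1) + z (t + 1 + 1))) - D⁻¹) =
        F / D * ((z (t + 2) ^ 2 - z (t + 1) * z (t + 3)) /
          ((z (t + 1) + z (t + 2)) * (z (t + 2) + z (t + 3)))) := by
      simp only [add_assoc]; norm_num; field_simp; ring
    have e2 : F / D * (z (t + 1) / (z (t + 1) + z (t + 1 + 1))) - D⁻¹ -
        (F / D * (z t / (z t + z (t + 1))) - D⁻¹) =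
        F / D * ((z (t + 1) ^ 2 - z t * z (t + 2)) /
          ((z t + z (t + 1)) * (z (t + 1) + z (t + 2)))) := by
      simp only [add_assoc]; norm_num; field_simp; ring
    rw [e1, e2]
    have hc : z (t + 2) ^ 2 - z (t + 1) * z (t + 3) = z (t + 1) ^ 2 - z t * z (t + 2) := by
      simp only [hz]; rw [pathSeq_casoratian, pathSeq_casoratian]
    rw [hc]
    refine mul_lt_mul_of_pos_left ?_ (by positivity)
    refine div_lt_div_of_pos_left (zcas t) (by positivity) ?_
    have := zlt t; have := zlt (t + 1); have := zlt (t + 2)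
    simp only [add_assoc] at *; norm_num at *
    nlinarith
  refine ⟨α, α0, fun t => ?_, fun t => ?_, fun p q hp hq => add_lt_of_strictConcave α0 conc hp hq,
    fun p q hp hq => ?_, fun t => ?_⟩
  · rw [hden]; have := zpos t; have := zpos (t + 1); positivity
  · cases t with
    | zero => exact α0.ge
    | succ t =>
      rw [hsuc]
      have a0 := zpos t; have a1 := zpos (t + 1)
      have : 1 ≤ D / F := by rw [le_div_iff₀ hF0]; simp only [hD, hF]; linarith
      have : 0 < z t / z (t + 1) := by positivity
      nlinarith
  · have := add_lt_of_strictConcave (f := fun t => (D - α t)⁻¹ - D⁻¹) (by simp [α0]) conc' hp hq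
    linarith
  · rw [hinv, hsuc]
    have a0 := zpos t; have a1 := zpos (t + 1)
    field_simp
    simp only [hD, hF]; ring

/-- Distributing a total length over several branches does not decrease the sum of the responses,
and keeps it only if at most one branch is used. -/
theorem IsResponse.sum_inv {m : ℕ} {D : ℝ} {α : ℕ → ℝ} (h : IsResponse m D α) {W : Type*}
    (s : Finset W) (p : W → ℕ) :
    (D - α (∑ w ∈ s, p w))⁻¹ - D⁻¹ ≤ ∑ w ∈ s, ((D - α (p w))⁻¹ - D⁻¹) ∧
      ((D - α (∑ w ∈ s, p w))⁻¹ - D⁻¹ = ∑ w ∈ s, ((D - α (p w))⁻¹ - D⁻¹) →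
        ∀ v ∈ s, ∀ w ∈ s, v ≠ w → p v = 0 ∨ p w = 0) := by
  classical
  induction s using Finset.induction_on with
  | empty => simp [h.zero]
  | insert a s ha ih =>
    rw [Finset.sum_insert ha, Finset.sum_insert ha]
    rcases Nat.eq_zero_or_pos (p a) with h0 | h0
    · simp only [h0, h.zero, zero_add, sub_zero, sub_self]
      refine ⟨ih.1, fun heq v hv w hw hvw => ?_⟩
      rcases Finset.mem_insert.1 hv with rfl | hv
      · exact Or.inl h0
      rcases Finset.mem_insert.1 hw with rfl | hw
      · exact Or.inr h0
      exact ih.2 heq v hv w hw hvw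
    · rcases Nat.eq_zero_or_pos (∑ w ∈ s, p w) with h1 | h1
      · have hz : ∀ w ∈ s, p w = 0 := fun w hw => Finset.sum_eq_zero_iff.1 h1 w hw
        rw [h1]
        have : ∑ w ∈ s, ((D - α (p w))⁻¹ - D⁻¹) = 0 :=
          Finset.sum_eq_zero fun w hw => by rw [hz w hw, h.zero]; simp
        rw [this]
        refine ⟨by simp, fun _ v hv w hw hvw => ?_⟩
        rcases Finset.mem_insert.1 hv with rfl | hv
        · rcases Finset.mem_insert.1 hw with rfl | hw
          · exact absurd rfl hvw
          · exact Or.inr (hz w hw)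
        · exact Or.inl (hz v hv)
      · have h2 := h.inv_add_lt (p a) (∑ w ∈ s, p w) h0 h1
        have h3 := ih.1
        exact ⟨by linarith, fun heq => by linarith⟩

/-! ### The adjacency operator and its quadratic form as sums over edges. -/

section EdgeSums

variable {V W : Type*} [DecidableEq V] [DecidableEq W]

/-- The sum, over the edges at `w`, of the values of `y` at the other vertices of the edge. -/
def edgeOp (E : Finset (Finset V)) (y : V → ℝ) (w : V) : ℝ :=
  ∑ e ∈ E with w ∈ e, (∑ v ∈ e, y v - y w)

/-- The quadratic form of `edgeOp`. -/
def edgeForm (E : Finset (Finset V)) (y : V → ℝ) : ℝ :=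
  ∑ e ∈ E, ((∑ v ∈ e, y v) ^ 2 - ∑ v ∈ e, y v ^ 2)

theorem sum_mul_edgeOp [Fintype V] (E : Finset (Finset V)) (x y : V → ℝ) :
    ∑ v, x v * edgeOp E y v =
      ∑ e ∈ E, ((∑ v ∈ e, x v) * (∑ v ∈ e, y v) - ∑ v ∈ e, x v * y v) := by
  simp only [edgeOp, Finset.sum_filter, Finset.mul_sum, mul_ite, mul_zero]
  rw [Finset.sum_comm]
  refine Finset.sum_congr rfl fun e _ => ?_
  rw [Finset.sum_ite_mem, Finset.univ_inter]
  simp only [mul_sub, Finset.sum_sub_distrib]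
  rw [← Finset.sum_mul, ← Finset.mul_sum]

theorem sum_mul_edgeOp_self [Fintype V] (E : Finset (Finset V)) (y : V → ℝ) :
    ∑ v, y v * edgeOp E y v = edgeForm E y := by
  rw [sum_mul_edgeOp, edgeForm]
  simp only [sq]

theorem sum_mul_edgeOp_comm [Fintype V] (E : Finset (Finset V)) (x y : V → ℝ) :
    ∑ v, x v * edgeOp E y v = ∑ v, y v * edgeOp E x v := by
  rw [sum_mul_edgeOp, sum_mul_edgeOp]
  refine Finset.sum_congr rfl fun e _ => ?_
  rw [mul_comm]
  simp only [mul_comm]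

theorem edgeOp_nonneg (E : Finset (Finset V)) {y : V → ℝ} (hy : ∀ v, 0 ≤ y v) (w : V) :
    0 ≤ edgeOp E y w := by
  refine Finset.sum_nonneg fun e he => ?_
  rw [Finset.mem_filter] at he
  have := Finset.single_le_sum (fun v _ => hy v) he.2
  linarith

theorem edgeOp_union {E F : Finset (Finset V)} (h : Disjoint E F) (y : V → ℝ) (w : V) :
    edgeOp (E ∪ F) y w = edgeOp E y w + edgeOp F y w := by
  rw [edgeOp, Finset.filter_union, Finset.sum_union (Finset.disjoint_filter_filter h)]
  rfl

theorem edgeForm_union {E F : Finset (Finset V)} (h : Disjoint E F) (y : V → ℝ) :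
    edgeForm (E ∪ F) y = edgeForm E y + edgeForm F y := Finset.sum_union h

theorem edgeOp_insert {E : Finset (Finset V)} {e : Finset V} (h : e ∉ E) (y : V → ℝ) (w : V) :
    edgeOp (insert e E) y w = edgeOp E y w + if w ∈ e then ∑ v ∈ e, y v - y w else 0 := by
  rw [edgeOp, Finset.filter_insert]
  split_ifs with hw
  · rw [Finset.sum_insert (by simp [h]), add_comm]; rfl
  · simp [edgeOp]

theorem edgeOp_congr {E : Finset (Finset V)} {y z : V → ℝ} {w : V}
    (h : ∀ e ∈ E, w ∈ e → ∀ v ∈ e, y v = z v) : edgeOp E y w = edgeOp E z w := by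
  refine Finset.sum_congr rfl fun e he => ?_
  rw [Finset.mem_filter] at he
  rw [Finset.sum_congr rfl (h e he.1 he.2), h e he.1 he.2 w he.2]

theorem edgeOp_eq_zero {E : Finset (Finset V)} {w : V} (h : ∀ e ∈ E, w ∉ e) (y : V → ℝ) :
    edgeOp E y w = 0 := by
  rw [edgeOp, Finset.filter_false_of_mem h, Finset.sum_empty]

theorem edgeOp_map (φ : V ↪ W) (E : Finset (Finset V)) (y : W → ℝ) (v : V) :
    edgeOp (E.map (Finset.mapEmbedding φ).toEmbedding) y (φ v) = edgeOp E (y ∘ φ) v := by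
  simp only [edgeOp, Finset.sum_filter, Finset.sum_map, RelEmbedding.coe_toEmbedding,
    Finset.mapEmbedding_apply, Finset.mem_map', Function.comp]

omit [DecidableEq V] in
theorem edgeOp_map_of_notMem (φ : V ↪ W) (E : Finset (Finset V)) (y : W → ℝ) {w : W}
    (hw : w ∉ Set.range φ) :
    edgeOp (E.map (Finset.mapEmbedding φ).toEmbedding) y w = 0 := by
  refine edgeOp_eq_zero (fun e he hwe => hw ?_) y
  simp only [Finset.mem_map] at he
  obtain ⟨f, _, rfl⟩ := he
  simp only [RelEmbedding.coe_toEmbedding, Finset.mapEmbedding_apply, Finset.mem_map] at hwe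
  obtain ⟨v, _, rfl⟩ := hwe
  exact ⟨v, rfl⟩

omit [DecidableEq V] [DecidableEq W] in
theorem edgeForm_map (φ : V ↪ W) (E : Finset (Finset V)) (y : W → ℝ) :
    edgeForm (E.map (Finset.mapEmbedding φ).toEmbedding) y = edgeForm E (y ∘ φ) := by
  simp [edgeForm]

/-- In each edge the squares cancel, leaving twice the sum of products over pairs. The form is
therefore affine in every single coordinate. -/
theorem edgeForm_update (E : Finset (Finset V)) (y : V → ℝ) (v : V) (c : ℝ) :
    edgeForm E (Function.update y v c) = edgeForm E y + 2 * (c - y v) * edgeOp E y v := by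
  rw [edgeForm, edgeForm, edgeOp, Finset.sum_filter, Finset.mul_sum, ← Finset.sum_add_distrib]
  refine Finset.sum_congr rfl fun e _ => ?_
  split_ifs with hv
  · have h1 : ∀ f : V → ℝ, ∑ w ∈ e, f w = f v + ∑ w ∈ e.erase v, f w := fun f =>
      (Finset.add_sum_erase e f hv).symm
    have h2 : ∑ w ∈ e.erase v, Function.update y v c w = ∑ w ∈ e.erase v, y w :=
      Finset.sum_congr rfl fun w hw => Function.update_of_ne (Finset.ne_of_mem_erase hw) _ _
    have h3 : ∑ w ∈ e.erase v, Function.update y v c w ^ 2 = ∑ w ∈ e.erase v, y w ^ 2 :=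
      Finset.sum_congr rfl fun w hw => by rw [Function.update_of_ne (Finset.ne_of_mem_erase hw)]
    rw [h1 (Function.update y v c), h1 (fun w => Function.update y v c w ^ 2), h2, h3, h1 y,
      h1 (fun w => y w ^ 2)]
    simp only [Function.update_self]
    ring
  · have h2 : ∑ w ∈ e, Function.update y v c w = ∑ w ∈ e, y w :=
      Finset.sum_congr rfl fun w hw => Function.update_of_ne (ne_of_mem_of_not_mem hw hv) _ _
    have h3 : ∑ w ∈ e, Function.update y v c w ^ 2 = ∑ w ∈ e, y w ^ 2 :=
      Finset.sum_congr rfl fun w hw => by rw [Function.update_of_ne (ne_of_mem_of_not_mem hw hv)]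
    rw [h2, h3]; ring

/-- If every edge at `a` also contains `v`, then moving the larger value from `a` to `v` does not
decrease the form, and increases it if some edge contains `v` but not `a`. -/
theorem edgeForm_lt_swap {E : Finset (Finset V)} {y : V → ℝ} (hy : ∀ u, 0 < y u) {a v : V}
    (hva : y v < y a) (hE : ∀ e ∈ E, a ∈ e → v ∈ e) {e₀ : Finset V} (h0 : e₀ ∈ E) (hv0 : v ∈ e₀)
    (ha0 : a ∉ e₀) (hc : 2 ≤ e₀.card) :
    edgeForm E y < edgeForm E (y ∘ Equiv.swap a v) := by
  have key : ∀ e : Finset V, v ∈ e → a ∉ e →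
      ((∑ u ∈ e, (y ∘ Equiv.swap a v) u) ^ 2 - ∑ u ∈ e, (y ∘ Equiv.swap a v) u ^ 2) =
        ((∑ u ∈ e, y u) ^ 2 - ∑ u ∈ e, y u ^ 2) + 2 * (y a - y v) * ∑ u ∈ e.erase v, y u := by
    intro e hv ha
    have h1 : ∀ f : V → ℝ, ∑ w ∈ e, f w = f v + ∑ w ∈ e.erase v, f w := fun f =>
      (Finset.add_sum_erase e f hv).symm
    have h2 : ∀ w ∈ e.erase v, (y ∘ Equiv.swap a v) w = y w := fun w hw => by
      have hw' := Finset.mem_erase.1 hw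
      simp only [Function.comp]
      rw [Equiv.swap_apply_of_ne_of_ne (ne_of_mem_of_not_mem hw'.2 ha) hw'.1]
    rw [h1 (y ∘ Equiv.swap a v), h1 (fun w => (y ∘ Equiv.swap a v) w ^ 2), h1 y,
      h1 (fun w => y w ^ 2), Finset.sum_congr rfl h2,
      Finset.sum_congr rfl (fun w hw => congrArg (· ^ 2) (h2 w hw))]
    simp only [Function.comp, Equiv.swap_apply_right]
    ring
  refine Finset.sum_lt_sum (fun e he => ?_) ⟨e₀, h0, ?_⟩
  · by_cases hv : v ∈ e
    · by_cases ha : a ∈ e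
      · have hs : e.map (Equiv.swap a v).toEmbedding = e := by
          ext u
          simp only [Finset.mem_map_equiv, Equiv.symm_swap]
          by_cases h1 : u = a
          · subst h1; simp [ha, hv]
          by_cases h2 : u = v
          · subst h2; simp [ha, hv]
          rw [Equiv.swap_apply_of_ne_of_ne h1 h2]
        have hsum : ∀ f : V → ℝ, ∑ u ∈ e, f (Equiv.swap a v u) = ∑ u ∈ e, f u := by
          intro f
          conv_rhs => rw [← hs, Finset.sum_map]
          rfl
        have e1 := hsum y
        have e2 := hsum (fun u => y u ^ 2)
        simp only [Function.comp]
        rw [e1, e2]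
      · rw [key e hv ha]
        have : 0 ≤ ∑ u ∈ e.erase v, y u := Finset.sum_nonneg fun u _ => (hy u).le
        nlinarith
    · have ha : a ∉ e := fun h => hv (hE e he h)
      have h2 : ∀ w ∈ e, (y ∘ Equiv.swap a v) w = y w := fun w hw => by
        simp only [Function.comp]
        rw [Equiv.swap_apply_of_ne_of_ne (ne_of_mem_of_not_mem hw ha) (ne_of_mem_of_not_mem hw hv)]
      rw [Finset.sum_congr rfl h2,
        Finset.sum_congr rfl (fun w hw => congrArg (· ^ 2) (h2 w hw))]
  · rw [key e₀ hv0 ha0]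
    have : 0 < ∑ u ∈ e₀.erase v, y u := by
      refine Finset.sum_pos (fun u _ => hy u) ?_
      rw [← Finset.card_pos, Finset.card_erase_of_mem hv0]; omega
    have : 0 < (y a - y v) * ∑ u ∈ e₀.erase v, y u := mul_pos (by linarith) this
    linarith

end EdgeSums

/-! ### Passage from the adjacency matrix to edge sums. -/

namespace SimpleHypergraph

universe u v

variable {V : Type u} {W : Type v}

open Classical in
/-- The edges of a hypergraph on a finite vertex set, as a finset of finsets. -/
noncomputable def edges [Fintype V] (H : SimpleHypergraph V) : Finset (Finset V) :=
  {e : Finset V | (e : Set V) ∈ H.edgeSet}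

theorem mem_edges [Fintype V] {H : SimpleHypergraph V} {e : Finset V} :
    e ∈ H.edges ↔ (e : Set V) ∈ H.edgeSet := by simp [edges]

theorem IsUniform.card_of_mem_edges [Fintype V] {H : SimpleHypergraph V} {k : ℕ}
    (h : H.IsUniform k) {e : Finset V} (he : e ∈ H.edges) : e.card = k := by
  rw [← h _ (mem_edges.1 he), Set.ncard_coe_finset]

/-- Uniformity makes all weights equal to 1 / m, so one factor m clears them. For m = 0 there are no
edges, since edges have at least two vertices. -/
theorem IsUniform.adjMatrix_mulVec [Fintype V] [DecidableEq V] {H : SimpleHypergraph V} {m : ℕ}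
    (h : H.IsUniform (m + 1)) (y : V → ℝ) (v : V) :
    m * (H.adjMatrix *ᵥ y) v = edgeOp H.edges y v := by
  rcases Nat.eq_zero_or_pos m with rfl | hm
  · have : H.edges = ∅ := by
      refine Finset.eq_empty_of_forall_notMem fun e he => ?_
      have h1 := H.two_le_ncard _ (mem_edges.1 he)
      rw [h _ (mem_edges.1 he)] at h1
      omega
    simp [this, edgeOp]
  have hm' : (m : ℝ) ≠ 0 := by positivity
  have key : ∀ w, H.adjMatrix v w =
      ∑ e ∈ H.edges, if v ∈ e ∧ w ∈ e ∧ w ≠ v then 1 / (m : ℝ) else 0 := by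
    intro w
    by_cases hvw : v = w
    · subst hvw; simp [adjMatrix]
    · classical
      simp only [adjMatrix, Matrix.of_apply, if_neg hvw, ne_eq, Ne.symm hvw, not_false_iff,
        and_true]
      rw [← Finset.sum_filter]
      symm
      refine Finset.sum_bij (fun e _ => (e : Set V)) ?_ ?_ ?_ ?_
      · intro e he; simpa [mem_edges] using he
      · intro e _ f _ hef; exact_mod_cast hef
      · intro e he
        refine ⟨e.toFinset, ?_, by simp⟩
        simpa [mem_edges] using he
      · intro e he
        rw [Finset.mem_filter] at he
        rw [h _ (mem_edges.1 he.1)]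
        push_cast; ring
  simp only [Matrix.mulVec, dotProduct, key, Finset.mul_sum, Finset.sum_mul, edgeOp,
    Finset.sum_filter]
  rw [Finset.sum_comm]
  refine Finset.sum_congr rfl fun e _ => ?_
  by_cases hv : v ∈ e
  · simp only [hv, true_and, if_true]
    rw [← Finset.sum_erase_eq_sub hv]
    have : e.erase v = Finset.univ.filter (fun w => w ∈ e ∧ w ≠ v) := by
      ext w; simp [and_comm]
    rw [this, Finset.sum_filter]
    refine Finset.sum_congr rfl fun w _ => ?_
    split_ifs
    · field_simp
    · simp
  · simp [hv]

theorem adjMatrix_nonneg [Fintype V] (H : SimpleHypergraph V) (i j : V) :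
    0 ≤ H.adjMatrix i j := by
  simp only [adjMatrix, Matrix.of_apply]
  split_ifs
  · exact le_rfl
  · classical
    refine Finset.sum_nonneg fun e he => ?_
    rw [Finset.mem_filter] at he
    have : (2 : ℝ) ≤ e.ncard := by exact_mod_cast H.two_le_ncard e he.2.1
    exact div_nonneg zero_le_one (by linarith)

theorem Iso.rho_eq [Fintype V] [Fintype W] {G : SimpleHypergraph V} {H : SimpleHypergraph W}
    (φ : G.Iso H) : G.rho = H.rho := by
  classical
  have h : H.adjMatrix = Matrix.reindexAlgEquiv ℝ ℝ φ.toEquiv G.adjMatrix := by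
    ext i j
    obtain ⟨i, rfl⟩ := φ.toEquiv.surjective i
    obtain ⟨j, rfl⟩ := φ.toEquiv.surjective j
    simp only [adjMatrix, Matrix.coe_reindexAlgEquiv, Matrix.reindex_apply,
      Matrix.submatrix_apply, Equiv.symm_apply_apply, Matrix.of_apply, EmbeddingLike.apply_eq_iff_eq]
    split_ifs
    · rfl
    symm
    refine Finset.sum_bij (fun e _ => φ.toEquiv '' e) ?_ ?_ ?_ ?_
    · intro e he
      simpa [φ.image_mem_edgeSet_iff] using he
    · intro e _ f _ hef
      exact φ.toEquiv.injective.image_injective hef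
    · intro e he
      refine ⟨φ.toEquiv ⁻¹' e, ?_, by simp⟩
      have := φ.image_mem_edgeSet_iff (φ.toEquiv ⁻¹' e)
      rw [Set.image_preimage_eq _ φ.toEquiv.surjective] at this
      simpa [← this] using he
    · intro e _
      rw [Set.ncard_image_of_injective _ φ.toEquiv.injective]
  have h2 : spectrum ℝ H.adjMatrix = spectrum ℝ G.adjMatrix := by
    rw [h]; exact AlgEquiv.spectrum_eq _ _
  rw [rho, rho, spectralRadius, spectralRadius]
  convert congrArg (fun S : Set ℝ => (⨆ k ∈ S, (‖k‖₊ : ENNReal)).toReal) h2.symm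

end SimpleHypergraph

/-! ### Rooted hypertrees and the comparison of their responses with that of a hyperpath. -/

section Hypertrees

variable {V : Type*} [DecidableEq V]

/-- `E` is the edge set of an `(m + 1)`-uniform supertree with vertex set `U`, grown from the root
`r` by attaching one edge at a time. -/
inductive IsHypertreeOn (m : ℕ) (r : V) : Finset (Finset V) → Finset V → Prop
  | root : IsHypertreeOn m r ∅ {r}
  | attach {E : Finset (Finset V)} {U e : Finset V} {u : V} (h : IsHypertreeOn m r E U)
      (hu : e ∩ U = {u}) (hc : e.card = m + 1) : IsHypertreeOn m r (insert e E) (U ∪ e)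

/-- `E` is the edge set of an `(m + 1)`-uniform hyperpath from `r` to `t` with vertex set `U`. -/
inductive IsHyperpathOn (m : ℕ) (r : V) : Finset (Finset V) → Finset V → V → Prop
  | root : IsHyperpathOn m r ∅ {r} r
  | attach {E : Finset (Finset V)} {U e : Finset V} {u t : V} (h : IsHyperpathOn m r E U u)
      (hu : e ∩ U = {u}) (hc : e.card = m + 1) (ht : t ∈ e) (htu : t ≠ u) :
      IsHyperpathOn m r (insert e E) (U ∪ e) t

variable {m : ℕ} {r : V} {E : Finset (Finset V)} {U : Finset V}

theorem IsHyperpathOn.isHypertreeOn {t : V} (h : IsHyperpathOn m r E U t) :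
    IsHypertreeOn m r E U := by
  induction h with
  | root => exact .root
  | attach h hu hc ht htu ih => exact .attach ih hu hc

namespace IsHypertreeOn

theorem root_mem (h : IsHypertreeOn m r E U) : r ∈ U := by
  induction h with
  | root => simp
  | attach h hu hc ih => exact Finset.mem_union_left _ ih

theorem subset (h : IsHypertreeOn m r E U) : ∀ e ∈ E, e ⊆ U := by
  induction h with
  | root => simp
  | attach h hu hc ih =>
    intro f hf
    rcases Finset.mem_insert.1 hf with rfl | hf
    · exact Finset.subset_union_right
    · exact (ih f hf).trans Finset.subset_union_left

theorem card_of_mem (h : IsHypertreeOn m r E U) : ∀ e ∈ E, e.card = m + 1 := by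
  induction h with
  | root => simp
  | attach h hu hc ih =>
    intro f hf
    rcases Finset.mem_insert.1 hf with rfl | hf
    · exact hc
    · exact ih f hf

theorem notMem (hm : 1 ≤ m) (h : IsHypertreeOn m r E U) {e : Finset V} {u : V}
    (hu : e ∩ U = {u}) (hc : e.card = m + 1) : e ∉ E := by
  intro he
  have := h.subset e he
  rw [Finset.inter_eq_left.2 this] at hu
  rw [hu, Finset.card_singleton] at hc
  omega

end IsHypertreeOn

theorem union_eq_union_erase {U e : Finset V} {u : V} (hu : e ∩ U = {u}) :
    U ∪ e = U ∪ e.erase u := by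
  have : u ∈ e ∩ U := by simp [hu]
  rw [Finset.mem_inter] at this
  ext v
  by_cases hv : v = u
  · subst hv; simp [this]
  · simp [hv]

theorem disjoint_erase_of_inter_eq {U e : Finset V} {u : V} (hu : e ∩ U = {u}) :
    Disjoint U (e.erase u) := by
  rw [Finset.disjoint_left]
  intro v hv hve
  rw [Finset.mem_erase] at hve
  have : v ∈ e ∩ U := Finset.mem_inter.2 ⟨hve.2, hv⟩
  rw [hu, Finset.mem_singleton] at this
  exact hve.1 this

theorem IsHypertreeOn.card_eq (hm : 1 ≤ m) (h : IsHypertreeOn m r E U) :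
    U.card = E.card * m + 1 := by
  induction h with
  | root => simp
  | @attach E U e u h hu hc ih =>
    have hue : u ∈ e := (Finset.mem_inter.1 (by rw [hu]; simp : u ∈ e ∩ U)).1
    rw [union_eq_union_erase hu, Finset.card_union_of_disjoint (disjoint_erase_of_inter_eq hu),
      Finset.card_insert_of_notMem (h.notMem hm hu hc), Finset.card_erase_of_mem hue, ih, hc]
    rw [Nat.add_sub_cancel]; ring

/-- A property that is passed on along edges and holds somewhere in a hypertree holds everywhere in
it. -/
theorem IsHypertreeOn.forall_of_exists (h : IsHypertreeOn m r E U) {P : V → Prop}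
    (hP : ∀ e ∈ E, ∀ v ∈ e, ∀ w ∈ e, P v → P w) (hex : ∃ v ∈ U, P v) : ∀ v ∈ U, P v := by
  -- Propagation from the root suffices: the hypothesis on P is symmetric in v and w, hence also
  -- holds for the negation of P, and this excludes that P fails at the root.
  have key : ∀ P : V → Prop, (∀ e ∈ E, ∀ v ∈ e, ∀ w ∈ e, P v → P w) → P r → ∀ v ∈ U, P v := by
    clear hex hP P
    induction h with
    | root => intro P _ hr v hv; rw [Finset.mem_singleton] at hv; exact hv ▸ hr
    | @attach E U e u h hu hc ih =>
      intro P hP hr v hv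
      have h1 := ih P (fun f hf => hP f (Finset.mem_insert_of_mem hf)) hr
      rcases Finset.mem_union.1 hv with hv | hv
      · exact h1 v hv
      · have hue := Finset.mem_inter.1 (by rw [hu]; simp : u ∈ e ∩ U)
        exact hP e (Finset.mem_insert_self _ _) u hue.1 v hv (h1 u hue.2)
  refine key P hP ?_
  by_contra hr
  obtain ⟨v, hv, hPv⟩ := hex
  exact key (fun v => ¬ P v) (fun e he v hv w hw hn hPw => hn (hP e he w hw v hv hPw)) hr v hv hPv

section Extend

variable {e : Finset V} {u : V}

theorem edgeOp_extend (hE : ∀ f ∈ E, f ⊆ U) (hu : e ∩ U = {u}) (he : e ∉ E) (y c : V → ℝ) (w : V) :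
    edgeOp (insert e E) (fun v => if v ∈ U then y v else c v) w =
      if w ∈ U then
        if w = u then edgeOp E y u + ∑ v ∈ e.erase u, c v else edgeOp E y w
      else if w ∈ e then y u + ∑ v ∈ e.erase u, c v - c w else 0 := by
  have hue := Finset.mem_inter.1 (by rw [hu]; simp : u ∈ e ∩ U)
  have hdis := disjoint_erase_of_inter_eq hu
  have hsum : ∑ v ∈ e, (if v ∈ U then y v else c v) = y u + ∑ v ∈ e.erase u, c v := by
    rw [← Finset.add_sum_erase e _ hue.1, if_pos hue.2]
    congr 1
    exact Finset.sum_congr rfl fun v hv => if_neg (Finset.disjoint_right.1 hdis hv)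
  rw [edgeOp_insert he, hsum]
  by_cases hwU : w ∈ U
  · rw [if_pos hwU]
    have h1 : edgeOp E (fun v => if v ∈ U then y v else c v) w = edgeOp E y w :=
      edgeOp_congr fun f hf _ v hv => if_pos (hE f hf hv)
    rw [h1]
    by_cases hwu : w = u
    · subst hwu
      simp only [if_pos hue.1, if_pos hwU, if_true]; ring
    · have : w ∉ e := fun hwe => hwu (by
        have : w ∈ e ∩ U := Finset.mem_inter.2 ⟨hwe, hwU⟩
        rwa [hu, Finset.mem_singleton] at this)
      simp [this, hwu, hwU]
  · have h1 : ∀ y, edgeOp E y w = 0 := fun y => edgeOp_eq_zero (fun f hf hwf => hwU (hE f hf hwf)) y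
    simp [hwU, h1]

/-- The vector on a new pendant edge. -/
noncomputable def pendantVector (D : ℝ) (α : ℕ → ℝ) (p : V → ℕ) (e : Finset V) (u : V) (yu : ℝ)
    (v : V) : ℝ :=
  yu * (1 + α (∑ w ∈ e.erase u, p w + 1)) * (D - α (p v))⁻¹

/-- Folding the pendant edge and the virtual hyperpaths on it into one virtual hyperpath at u
preserves the total length. This keeps the index of `α` at the root constant during the induction.
-/
theorem sum_update_of_pendant (p : V → ℕ) (hu : e ∩ U = {u}) (he : e ∉ E) :
    E.card + ∑ w ∈ U, Function.update p u (p u + (∑ w ∈ e.erase u, p w + 1)) w =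
      (insert e E).card + ∑ w ∈ U ∪ e, p w := by
  have hue := Finset.mem_inter.1 (by rw [hu]; simp : u ∈ e ∩ U)
  rw [Finset.card_insert_of_notMem he, union_eq_union_erase hu,
    Finset.sum_union (disjoint_erase_of_inter_eq hu), Finset.sum_update_of_mem hue.2,
    ← Finset.add_sum_erase U p hue.2, Finset.sdiff_singleton_eq_erase]
  ring

theorem IsResponse.one_add_pos {D : ℝ} {α : ℕ → ℝ} (hα : IsResponse m D α) (t : ℕ) :
    0 < 1 + α t := by have := hα.nonneg t; linarith

variable {D : ℝ} {α : ℕ → ℝ}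

/-- If the edge has total S, the equation at a vertex v with a virtual hyperpath of length p v gives
it the value S / (D - α (p v)). With S prescribed as y u times 1 + α n, its value for a hyperpath of
length n, the right side is the contribution of the edge at u divided by y u. Subadditivity from
`sum_inv` bounds it from below, and `succ` evaluates the bound as α n. -/
theorem IsResponse.le_sum_pendant (hα : IsResponse m D α) (p : V → ℕ) (hue : u ∈ e)
    (hc : e.card = m + 1) :
    α (∑ w ∈ e.erase u, p w + 1) ≤
      (1 + α (∑ w ∈ e.erase u, p w + 1)) * ∑ v ∈ e.erase u, (D - α (p v))⁻¹ ∧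
    (α (∑ w ∈ e.erase u, p w + 1) =
      (1 + α (∑ w ∈ e.erase u, p w + 1)) * ∑ v ∈ e.erase u, (D - α (p v))⁻¹ →
        ∀ v ∈ e.erase u, ∀ w ∈ e.erase u, v ≠ w → p v = 0 ∨ p w = 0) := by
  have h1 := hα.sum_inv (e.erase u) p
  have h2 := hα.succ (∑ w ∈ e.erase u, p w)
  have h3 := hα.one_add_pos (∑ w ∈ e.erase u, p w + 1)
  rw [Finset.sum_sub_distrib, Finset.sum_const, Finset.card_erase_of_mem hue, hc,
    Nat.add_sub_cancel, nsmul_eq_mul] at h1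
  set κ := 1 + α (∑ w ∈ e.erase u, p w + 1) with hκ
  have h4 : α (∑ w ∈ e.erase u, p w + 1) = κ - 1 := by rw [hκ]; ring
  rw [h4]
  constructor
  · have := mul_le_mul_of_nonneg_left h1.1 h3.le
    linarith
  · intro heq
    refine h1.2 ?_
    apply mul_left_cancel₀ h3.ne'
    linarith

/-- With all virtual length concentrated at one vertex t, nothing is lost to subadditivity, and
`succ` is exactly this identity. -/
theorem IsResponse.sum_pendant_eq (hα : IsResponse m D α) {p : V → ℕ} (hue : u ∈ e)
    (hc : e.card = m + 1) {t : V} (ht : t ∈ e) (htu : t ≠ u)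
    (hp : ∀ v ∈ e.erase u, v ≠ t → p v = 0) :
    α (∑ w ∈ e.erase u, p w + 1) =
      (1 + α (∑ w ∈ e.erase u, p w + 1)) * ∑ v ∈ e.erase u, (D - α (p v))⁻¹ := by
  have hte : t ∈ e.erase u := Finset.mem_erase.2 ⟨htu, ht⟩
  have h0 : ∑ w ∈ e.erase u, p w = p t := Finset.sum_eq_single_of_mem t hte hp
  have h1 : ∑ v ∈ e.erase u, ((D - α (p v))⁻¹ - D⁻¹) = (D - α (p t))⁻¹ - D⁻¹ :=
    Finset.sum_eq_single_of_mem t hte fun v hv hvt => by rw [hp v hv hvt, hα.zero]; simp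
  have h2 := hα.succ (p t)
  rw [Finset.sum_sub_distrib, Finset.sum_const, Finset.card_erase_of_mem hue, hc,
    Nat.add_sub_cancel, nsmul_eq_mul] at h1
  rw [h0, sub_eq_iff_eq_add.1 h1]
  linarith

end Extend

/-- Every rooted hypertree whose vertices `w` carry virtual pendant hyperpaths of length `p w`
has a positive vector that satisfies the eigenvalue inequality outside the root and whose response
at the root is at least that of a hyperpath of the same total length.  If all these are equalities,
then the hypertree together with the virtual hyperpaths is a hyperpath that starts at the root. -/
theorem IsHypertreeOn.exists_subinvariant (hm : 1 ≤ m) {D : ℝ} {α : ℕ → ℝ}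
    (hα : IsResponse m D α) (h : IsHypertreeOn m r E U) (p : V → ℕ) :
    ∃ y : V → ℝ, (∀ w, 0 < y w) ∧ y r = 1 ∧
      (∀ w ∈ U, (if w = r then α (E.card + ∑ v ∈ U, p v) else D - 1) * y w ≤
        edgeOp E y w + α (p w) * y w) ∧
      ((∀ w ∈ U, (if w = r then α (E.card + ∑ v ∈ U, p v) else D - 1) * y w =
        edgeOp E y w + α (p w) * y w) →
        ∃ t, IsHyperpathOn m r E U t ∧ ∀ w ∈ U, w ≠ t → p w = 0) := by
  induction h generalizing p with
  | root =>
    refine ⟨fun _ => 1, by simp, rfl, by simp [edgeOp], fun _ => ⟨r, .root, by simp⟩⟩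
  | @attach E U e u h hu hc ih =>
    have hue := Finset.mem_inter.1 (by rw [hu]; simp : u ∈ e ∩ U)
    have he := h.notMem hm hu hc
    have hrU := h.root_mem
    -- The last edge is replaced by a virtual hyperpath at u, of length one more than the virtual
    -- lengths it carries, added to the one already there.
    obtain ⟨y, hy0, hyr, hy, heq⟩ :=
      ih (Function.update p u (p u + (∑ w ∈ e.erase u, p w + 1)))
    rw [sum_update_of_pendant p hu he] at hy heq
    set n := ∑ w ∈ e.erase u, p w + 1 with hn
    set N := (insert e E).card + ∑ w ∈ U ∪ e, p w with hN
    set σ := ∑ v ∈ e.erase u, (D - α (p v))⁻¹ with hσ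
    have hκ := hα.one_add_pos n
    have hext := edgeOp_extend h.subset hu he y (pendantVector D α p e u (y u))
    have hcs : ∑ v ∈ e.erase u, pendantVector D α p e u (y u) v = y u * ((1 + α n) * σ) := by
      simp only [pendantVector]; rw [← Finset.mul_sum, mul_assoc]
    rw [hcs] at hext
    have hle := hα.le_sum_pendant (e := e) (u := u) p hue.1 hc
    rw [← hn, ← hσ] at hle
    -- Splitting the merged virtual hyperpath at u back into the new edge and the old virtual
    -- hyperpath can only increase the response; strictly so if p u > 0.
    have hsub : α (p u + n) ≤ α n + α (p u) := by
      rcases Nat.eq_zero_or_pos (p u) with h0 | h0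
      · rw [h0, zero_add, hα.zero, add_zero]
      · rw [add_comm (α n)]; exact (hα.add_lt (p u) n h0 (by omega)).le
    set y' : V → ℝ := fun v => if v ∈ U then y v else pendantVector D α p e u (y u) v with hy'
    have hyU : ∀ v ∈ U, y' v = y v := fun v hv => if_pos hv
    have hθu := hy u hue.2
    rw [Function.update_self] at hθu
    have h1 := mul_le_mul_of_nonneg_right hle.1 (hy0 u).le
    have h2 := mul_le_mul_of_nonneg_right hsub (hy0 u).le
    refine ⟨y', fun w => ?_, by rw [hyU r hrU, hyr], fun w hw => ?_, fun hall => ?_⟩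
    · by_cases hw : w ∈ U
      · rw [hyU w hw]; exact hy0 w
      · simp only [hy', if_neg hw, pendantVector]
        exact mul_pos (mul_pos (hy0 u) hκ) (inv_pos.2 (hα.pos_denom _))
    · rw [hext]
      by_cases hwU : w ∈ U
      · rw [if_pos hwU, hyU w hwU]
        by_cases hwu : w = u
        · subst hwu
          rw [if_pos rfl]
          linarith
        · rw [if_neg hwu]
          have := hy w hwU
          rwa [Function.update_of_ne hwu] at this
      · have hwe : w ∈ e := (Finset.mem_union.1 hw).resolve_left hwU
        have hwr : w ≠ r := fun h => hwU (h ▸ hrU)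
        rw [if_neg hwU, if_pos hwe, if_neg hwr]
        have hd := hα.pos_denom (p w)
        have hyw : y' w = pendantVector D α p e u (y u) w := if_neg hwU
        have : (D - α (p w)) * y' w = y u * (1 + α n) := by
          rw [hyw, pendantVector]; field_simp
          rw [mul_comm]
        rw [← hyw]
        linarith
    -- Two estimates were used at u, the splitting of the merged hyperpath and the bound for the
    -- edge. Equality at u makes both sharp.
    · have hpu : p u = 0 ∧ α n = (1 + α n) * σ := by
        have hu' := hall u (Finset.mem_union_left _ hue.2)
        rw [hext, if_pos hue.2, if_pos rfl, hyU u hue.2] at hu'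
        constructor
        · by_contra h0
          have h3 := hα.add_lt (p u) n (Nat.pos_of_ne_zero h0) (by omega)
          have := mul_lt_mul_of_pos_right h3 (hy0 u)
          linarith
        · apply mul_right_cancel₀ (hy0 u).ne'
          linarith
      obtain ⟨t, ht, hpt⟩ := heq fun w hwU => by
        have hw' := hall w (Finset.mem_union_left _ hwU)
        rw [hext, if_pos hwU, hyU w hwU] at hw'
        by_cases hwu : w = u
        · subst hwu
          rw [if_pos rfl, hpu.1, hα.zero, ← mul_assoc, mul_comm (y w)] at hw'
          rw [Function.update_self, hpu.1, zero_add, hw']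
          have := hpu.2
          rw [mul_assoc, mul_comm (y w), ← mul_assoc, ← this]
          ring
        · rw [if_neg hwu] at hw'
          rw [Function.update_of_ne hwu, hw']
      -- The merged virtual length at u is at least 1, and in the equality case only the end of the
      -- smaller hyperpath may carry positive length. So the new edge continues the hyperpath at its
      -- end.
      have hut : u = t := by
        by_contra hne
        have := hpt u hue.2 hne
        rw [Function.update_self] at this
        omega
      subst hut
      have hsupp := hle.2 hpu.2
      -- The new end is the vertex carrying positive virtual length, or any vertex of the edge other
      -- than u if there is none.
      have hex : ∃ t ∈ e.erase u, ∀ w ∈ e.erase u, w ≠ t → p w = 0 := by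
        by_cases h0 : ∃ t ∈ e.erase u, p t ≠ 0
        · obtain ⟨t, ht, h0⟩ := h0
          exact ⟨t, ht, fun w hw hwt => (hsupp w hw t ht hwt).resolve_right h0⟩
        · push Not at h0
          have : (e.erase u).Nonempty := by
            rw [← Finset.card_pos, Finset.card_erase_of_mem hue.1]; omega
          obtain ⟨t, ht⟩ := this
          exact ⟨t, ht, fun w hw _ => h0 w hw⟩
      obtain ⟨t, hte, hpt'⟩ := hex
      refine ⟨t, .attach ht hu hc (Finset.mem_of_mem_erase hte) (Finset.ne_of_mem_erase hte),
        fun w hw hwt => ?_⟩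
      rw [union_eq_union_erase hu] at hw
      rcases Finset.mem_union.1 hw with hw | hw
      · by_cases hwu : w = u
        · rw [hwu, hpu.1]
        · have := hpt w hw hwu
          rwa [Function.update_of_ne hwu] at this
      · exact hpt' w hw hwt

/-- On a hyperpath the vector of `IsHypertreeOn.exists_subinvariant` satisfies the eigenvalue
equations. -/
theorem IsHyperpathOn.exists_invariant (hm : 1 ≤ m) {D : ℝ} {α : ℕ → ℝ}
    (hα : IsResponse m D α) {t : V} (h : IsHyperpathOn m r E U t) (p : V → ℕ)
    (hp : ∀ w ∈ U, w ≠ t → p w = 0) :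
    ∃ y : V → ℝ, (∀ w, 0 < y w) ∧ y r = 1 ∧
      ∀ w ∈ U, (if w = r then α (E.card + ∑ v ∈ U, p v) else D - 1) * y w =
        edgeOp E y w + α (p w) * y w := by
  induction h generalizing p with
  | root => exact ⟨fun _ => 1, by simp, rfl, by simp [edgeOp]⟩
  | @attach E U e u t h hu hc ht htu ih =>
    have hue := Finset.mem_inter.1 (by rw [hu]; simp : u ∈ e ∩ U)
    have he := h.isHypertreeOn.notMem hm hu hc
    have hrU := h.isHypertreeOn.root_mem
    have htU : t ∉ U := fun h => htu (by
      have : t ∈ e ∩ U := Finset.mem_inter.2 ⟨ht, h⟩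
      rwa [hu, Finset.mem_singleton] at this)
    have hpU : ∀ w ∈ U, p w = 0 := fun w hw =>
      hp w (Finset.mem_union_left _ hw) (fun h => htU (h ▸ hw))
    -- The updated lengths are supported at u, the end of the shorter hyperpath, so the induction
    -- hypothesis applies.
    obtain ⟨y, hy0, hyr, hy⟩ :=
      ih (Function.update p u (p u + (∑ w ∈ e.erase u, p w + 1))) fun w hw hwu => by
        rw [Function.update_of_ne hwu]; exact hpU w hw
    rw [sum_update_of_pendant p hu he] at hy
    have hle := hα.sum_pendant_eq (p := p) hue.1 hc ht htu fun v hv =>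
      hp v (Finset.mem_union_right _ (Finset.mem_of_mem_erase hv))
    set n := ∑ w ∈ e.erase u, p w + 1 with hn
    set N := (insert e E).card + ∑ w ∈ U ∪ e, p w with hN
    set σ := ∑ v ∈ e.erase u, (D - α (p v))⁻¹ with hσ
    have hκ := hα.one_add_pos n
    have hext := edgeOp_extend h.isHypertreeOn.subset hu he y (pendantVector D α p e u (y u))
    have hcs : ∑ v ∈ e.erase u, pendantVector D α p e u (y u) v = y u * ((1 + α n) * σ) := by
      simp only [pendantVector]; rw [← Finset.mul_sum, mul_assoc]
    rw [hcs, ← hle] at hext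
    set y' : V → ℝ := fun v => if v ∈ U then y v else pendantVector D α p e u (y u) v with hy'
    have hyU : ∀ v ∈ U, y' v = y v := fun v hv => if_pos hv
    refine ⟨y', fun w => ?_, by rw [hyU r hrU, hyr], fun w hw => ?_⟩
    · by_cases hw : w ∈ U
      · rw [hyU w hw]; exact hy0 w
      · simp only [hy', if_neg hw, pendantVector]
        exact mul_pos (mul_pos (hy0 u) hκ) (inv_pos.2 (hα.pos_denom _))
    · rw [hext]
      by_cases hwU : w ∈ U
      · rw [if_pos hwU, hyU w hwU, hy w hwU]
        by_cases hwu : w = u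
        · subst hwu
          rw [if_pos rfl, Function.update_self, hpU w hwU, hα.zero, zero_add]
          ring
        · rw [if_neg hwu, Function.update_of_ne hwu]
      · have hwe : w ∈ e := (Finset.mem_union.1 hw).resolve_left hwU
        have hwr : w ≠ r := fun h => hwU (h ▸ hrU)
        rw [if_neg hwU, if_pos hwe, if_neg hwr]
        have hd := hα.pos_denom (p w)
        have hyw : y' w = pendantVector D α p e u (y u) w := if_neg hwU
        have : (D - α (p w)) * y' w = y u * (1 + α n) := by
          rw [hyw, pendantVector]; field_simp
          rw [mul_comm]
        rw [← hyw]
        linarith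

end Hypertrees

/-! ### Supertrees can be grown edge by edge. -/

section EdgeGraph

variable {V : Type*}

/-- Two vertices are adjacent if they lie in a common edge. -/
def edgeGraph (E : Finset (Finset V)) : SimpleGraph V where
  Adj v w := v ≠ w ∧ ∃ e ∈ E, v ∈ e ∧ w ∈ e
  symm := ⟨by rintro v w ⟨h, e, he, hv, hw⟩; exact ⟨h.symm, e, he, hw, hv⟩⟩
  loopless := ⟨by rintro v ⟨h, -⟩; exact h rfl⟩

theorem edgeGraph_dist_le_one {E : Finset (Finset V)} {e : Finset V} (he : e ∈ E) {v w : V}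
    (hv : v ∈ e) (hw : w ∈ e) : (edgeGraph E).dist v w ≤ 1 := by
  by_cases h : v = w
  · subst h; simp
  · have hadj : (edgeGraph E).Adj v w := ⟨h, e, he, hv, hw⟩
    exact (SimpleGraph.dist_eq_one_iff_adj.2 hadj).le

theorem IsHypertreeOn.reachable [DecidableEq V] {m : ℕ} {r : V} {E : Finset (Finset V)}
    {U : Finset V} (h : IsHypertreeOn m r E U) {v w : V} (hv : v ∈ U) (hw : w ∈ U) :
    (edgeGraph E).Reachable v w := by
  refine h.forall_of_exists (P := fun w => (edgeGraph E).Reachable v w) ?_ ⟨v, hv, .refl _⟩ w hw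
  intro e he a ha b hb hva
  by_cases hab : a = b
  · exact hab ▸ hva
  · have hadj : (edgeGraph E).Adj a b := ⟨hab, e, he, ha, hb⟩
    exact hva.trans hadj.reachable

end EdgeGraph

namespace SimpleHypergraph

universe u v

variable {V : Type u} {W : Type v}

theorem Acyclic.eq_of_mem_inter {T : SimpleHypergraph V} (hT : T.Acyclic) {e f : Set V}
    (he : e ∈ T.edgeSet) (hf : f ∈ T.edgeSet) (hef : e ≠ f) {a b : V} (ha : a ∈ e ∩ f)
    (hb : b ∈ e ∩ f) : a = b := by
  by_contra hab
  refine hT 2 ![a, b] ![e, f] ⟨le_rfl, ?_, ?_, ?_, ?_, by omega, ?_⟩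
  · intro i j; fin_cases i <;> fin_cases j <;> simp [hab, Ne.symm hab]
  · intro i j; fin_cases i <;> fin_cases j <;> simp [hef, Ne.symm hef]
  · intro i; fin_cases i <;> simp [he, hf]
  · intro i; fin_cases i <;> simp [cyclicSucc, ha.1, ha.2, hb.1, hb.2]
  · intro i j; fin_cases i <;> fin_cases j <;> simp [cyclicSucc]

/-- In an acyclic hypergraph, an edge that meets a connected set of other edges in two vertices does
not exist. -/
theorem Acyclic.eq_of_mem_of_reachable [Fintype V] {T : SimpleHypergraph V} (hT : T.Acyclic)
    {E : Finset (Finset V)} {U : Finset V} (hET : E ⊆ T.edges) (hEU : ∀ f ∈ E, f ⊆ U)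
    (hr : ∀ v ∈ U, ∀ w ∈ U, (edgeGraph E).Reachable v w) {e : Finset V} (he : e ∈ T.edges)
    (heE : e ∉ E) {a b : V} (ha : a ∈ e) (haU : a ∈ U) (hb : b ∈ e) (hbU : b ∈ U) : a = b := by
  classical
  by_contra hab
  have hlin : ∀ f ∈ T.edges, ∀ g ∈ T.edges, f ≠ g → ∀ a b, a ∈ f → a ∈ g → b ∈ f → b ∈ g →
      a = b := fun f hf g hg hfg a b haf hag hbf hbg =>
    hT.eq_of_mem_inter (mem_edges.1 hf) (mem_edges.1 hg) (fun h => hfg (by exact_mod_cast h))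
      ⟨haf, hag⟩ ⟨hbf, hbg⟩
  set d := (edgeGraph E).dist with hd
  have htri : ∀ u ∈ U, ∀ v ∈ U, ∀ w, d u w ≤ d u v + d v w := fun u hu v hv w =>
    (hr u hu v hv).dist_triangle_left w
  -- a pair of vertices of `e` at minimal distance
  obtain ⟨⟨a, b⟩, hmem, hmin⟩ := Finset.exists_min_image
    ((((e ∩ U) ×ˢ (e ∩ U)).filter fun z => z.1 ≠ z.2)) (fun z => d z.1 z.2)
    ⟨(a, b), by simp [ha, haU, hb, hbU, hab]⟩
  simp only [Finset.mem_filter, Finset.mem_product, Finset.mem_inter, ne_eq, Prod.forall,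
    and_imp] at hmem hmin
  obtain ⟨⟨⟨ha, haU⟩, hb, hbU⟩, hab⟩ := hmem
  obtain ⟨p, hp⟩ := (hr a haU b hbU).exists_walk_length_eq_dist
  set q := d a b with hq
  have hp' : p.length = q := hp
  have hadj : ∀ i, i < q → ∃ f ∈ E, p.getVert i ∈ f ∧ p.getVert (i + 1) ∈ f := fun i hi =>
    (p.adj_getVert_succ (by omega)).2
  choose! f hf hf1 hf2 using hadj
  set x : ℕ → V := p.getVert with hx
  have hx0 : x 0 = a := p.getVert_zero
  have hxq : x q = b := by rw [← hp']; exact p.getVert_length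
  have hxU : ∀ i, i ≤ q → x i ∈ U := by
    intro i hi
    rcases hi.lt_or_eq with hi | rfl
    · exact hEU _ (hf i hi) (hf1 i hi)
    · rw [hxq]; exact hbU
  have hd1 : ∀ g ∈ E, ∀ v ∈ g, ∀ w ∈ g, d v w ≤ 1 := fun g hg v hv w hw =>
    edgeGraph_dist_le_one hg hv hw
  have hle : ∀ i j, i ≤ j → j ≤ q → d (x i) (x j) ≤ j - i := by
    intro i j hij
    induction j, hij using Nat.le_induction with
    | base => intro _; simp [hd]
    | succ j hij ih =>
      intro hj
      have h1 := htri (x i) (hxU i (by omega)) (x j) (hxU j (by omega)) (x (j + 1))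
      have h2 := hd1 _ (hf j (by omega)) _ (hf1 j (by omega)) _ (hf2 j (by omega))
      have h3 := ih (by omega)
      omega
  have hge : ∀ i j, i ≤ j → j ≤ q → j - i ≤ d (x i) (x j) := by
    intro i j hij hj
    have h1 := htri (x 0) (hxU 0 (by omega)) (x i) (hxU i (by omega)) (x q)
    have h2 := htri (x i) (hxU i (by omega)) (x j) (hxU j (by omega)) (x q)
    have h3 := hle 0 i (by omega) (by omega)
    have h4 := hle j q (by omega) (by omega)
    have h5 : d (x 0) (x q) = q := by rw [hx0, hxq]
    omega
  have hq0 : 1 ≤ q := by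
    rcases Nat.eq_zero_or_pos q with h0 | h0
    · exact absurd (((hr a haU b hbU).dist_eq_zero_iff).1 h0) hab
    · exact h0
  -- For q = 1 a single edge of `E` would share two vertices with `e`, which is a hypercycle of
  -- length 2.
  have hq2 : 2 ≤ q := by
    by_contra hlt
    have h1 : q = 1 := by omega
    have hf2' := hf2 0 (by omega)
    rw [zero_add, ← h1, hxq] at hf2'
    exact hab (hlin e he (f 0) (hET (hf 0 (by omega))) (fun h => heE (h ▸ hf 0 (by omega))) a b ha
      (hx0 ▸ hf1 0 (by omega)) hb hf2')
  have hxinj : ∀ i j, i < j → j ≤ q → x i ≠ x j := by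
    intro i j hij hj h
    have h1 := hge i j hij.le hj
    rw [h] at h1
    have : d (x j) (x j) = 0 := SimpleGraph.dist_self
    omega
  have hfinj : ∀ i j, i < j → j < q → f i ≠ f j := by
    intro i j hij hj h
    have h1 := hge i (j + 1) (by omega) (by omega)
    have h2 := hd1 _ (hf j hj) _ (h ▸ hf1 i (by omega)) _ (hf2 j hj)
    omega
  have hdisj : ∀ i j, i + 2 ≤ j → j < q → Disjoint (f i : Set V) (f j) := by
    intro i j hij hj
    rw [Set.disjoint_left]
    intro v hvi hvj
    have hvi' : v ∈ f i := hvi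
    have hvj' : v ∈ f j := hvj
    have h1 := hge i (j + 1) (by omega) (by omega)
    have h2 := hd1 _ (hf i (by omega)) _ (hf1 i (by omega)) _ hvi'
    have h3 := hd1 _ (hf j (by omega)) _ hvj' _ (hf2 j (by omega))
    have h4 := htri _ (hxU i (by omega)) v (hEU _ (hf j hj) hvj') (x (j + 1))
    omega
  -- A common vertex other than a would be closer to a than b is, against the minimal choice; the
  -- vertex a itself is excluded by the geodesic.
  have hdisj' : ∀ i, 1 ≤ i → i + 1 < q → Disjoint (f i : Set V) e := by
    intro i hi1 hiq
    rw [Set.disjoint_left]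
    intro v hvi hve
    have hvi' : v ∈ f i := hvi
    have hve' : v ∈ e := hve
    have h1 := hd1 _ (hf i (by omega)) _ (hf1 i (by omega)) _ hvi'
    have hvU := hEU _ (hf i (by omega)) hvi'
    by_cases hva : a = v
    · have h2 := hge 0 (i + 1) (by omega) (by omega)
      rw [hx0, hva] at h2
      have h3 := hd1 _ (hf i (by omega)) _ hvi' _ (hf2 i (by omega))
      omega
    · have h2 := hmin a v ha haU hve' hvU hva
      have h3 := htri a haU (x i) (hxU i (by omega)) v
      have h4 := hle 0 i (by omega) (by omega)
      rw [hx0] at h4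
      omega
  have hsucc : ∀ i : Fin (q + 1), (cyclicSucc i).val = if i.val < q then i.val + 1 else 0 := by
    intro i
    have := i.isLt
    simp only [cyclicSucc]
    split_ifs with h
    · exact Nat.mod_eq_of_lt (by omega)
    · have : i.val = q := by omega
      rw [this, Nat.mod_self]
  set g : Fin (q + 1) → Finset V := fun i => if i.val < q then f i else e with hg
  have hgT : ∀ i, g i ∈ T.edges := by
    intro i; simp only [hg]; split_ifs with h
    · exact hET (hf _ h)
    · exact he
  have hginj : Function.Injective g := by
    intro i j hij
    have := i.isLt; have := j.isLt
    simp only [hg] at hij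
    split_ifs at hij with h1 h2 h2
    · rcases lt_trichotomy i.val j.val with h | h | h
      · exact absurd hij (hfinj _ _ h h2)
      · exact Fin.ext h
      · exact absurd hij.symm (hfinj _ _ h h1)
    · exact absurd (hij ▸ hf _ h1) heE
    · exact absurd (hij ▸ hf _ h2) heE
    · exact Fin.ext (by omega)
  have hmemg : ∀ i : Fin (q + 1), x i ∈ g i ∧ x (cyclicSucc i) ∈ g i := by
    intro i
    have := i.isLt
    simp only [hg, hsucc]
    split_ifs with h
    · exact ⟨hf1 _ h, hf2 _ h⟩
    · have h1 : i.val = q := by omega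
      rw [h1, hxq, hx0]; exact ⟨hb, ha⟩
  have hdg : ∀ i j : Fin (q + 1), i.val < j.val → j ≠ cyclicSucc i → i ≠ cyclicSucc j →
      Disjoint (g i : Set V) (g j) := by
    intro i j hlt h1 h2
    have := j.isLt
    rw [ne_eq, Fin.ext_iff, hsucc, if_pos (by omega)] at h1
    rw [ne_eq, Fin.ext_iff, hsucc] at h2
    simp only [hg]
    rw [if_pos (show i.val < q by omega)]
    split_ifs at h2 ⊢ with h
    · exact hdisj _ _ (by omega) h
    · exact hdisj' _ (by omega) (by omega)
  refine hT (q + 1) (fun i => x i) (fun i => g i) ⟨by omega, ?_, ?_, ?_, hmemg, ?_, ?_⟩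
  · intro i j hij
    have := i.isLt; have := j.isLt
    rcases lt_trichotomy i.val j.val with h | h | h
    · exact absurd hij (hxinj _ _ h (by omega))
    · exact Fin.ext h
    · exact absurd hij.symm (hxinj _ _ h (by omega))
  · intro i j hij
    exact hginj (Finset.coe_injective hij)
  · exact fun i => mem_edges.1 (hgT i)
  · intro _ i
    have hne : i ≠ cyclicSucc i := by
      rw [ne_eq, Fin.ext_iff, hsucc]; split_ifs <;> omega
    ext v
    rw [Set.mem_inter_iff, Set.mem_singleton_iff]
    constructor
    · rintro ⟨h1, h2⟩
      exact hlin _ (hgT i) _ (hgT _) (fun h => hne (hginj h)) _ _ h1 h2 (hmemg i).2 (hmemg _).1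
    · rintro rfl
      exact ⟨(hmemg i).2, (hmemg _).1⟩
  · intro i j hij h1 h2
    rcases lt_trichotomy i.val j.val with h | h | h
    · exact hdg i j h h1 h2
    · exact absurd (Fin.ext h) hij
    · exact (hdg j i h h2 h1).symm

theorem Connected.eq_univ [Fintype V] {T : SimpleHypergraph V} (hT : T.Connected) {U : Finset V}
    {r : V} (hr : r ∈ U) (hU : ∀ e ∈ T.edges, ∀ v ∈ e, v ∈ U → e ⊆ U) : U = Finset.univ := by
  refine Finset.eq_univ_iff_forall.2 fun v => ?_
  obtain ⟨p⟩ := hT.preconnected r v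
  induction p with
  | nil => exact hr
  | cons h p ih =>
    refine ih ?_
    rw [SimpleGraph.fromRel_adj] at h
    classical
    rcases h.2 with ⟨e, he, h1, h2⟩ | ⟨e, he, h2, h1⟩ <;>
    · have := hU e.toFinset (by rw [mem_edges]; simpa using he) _ (by simpa using h1) hr
      exact this (by simpa using h2)

/-- A uniform supertree can be grown from any of its vertices. -/
theorem IsSupertree.isHypertreeOn [Fintype V] [DecidableEq V] {T : SimpleHypergraph V} {m : ℕ}
    (hm : 1 ≤ m) (hT : T.IsSupertree) (hu : T.IsUniform (m + 1)) (r : V) :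
    IsHypertreeOn m r T.edges Finset.univ := by
  classical
  -- Take a largest set of edges that can be grown from r. Any further edge meeting its vertex set
  -- does so in exactly one vertex by acyclicity, so it could be attached; connectedness then leaves
  -- nothing outside.
  obtain ⟨E, hmem, hmax⟩ := Finset.exists_max_image
    (T.edges.powerset.filter fun E => ∃ U, IsHypertreeOn m r E U) (fun E => E.card)
    ⟨∅, by simpa using ⟨_, IsHypertreeOn.root⟩⟩
  rw [Finset.mem_filter, Finset.mem_powerset] at hmem
  obtain ⟨hET, U, hU⟩ := hmem
  have hone : ∀ e ∈ T.edges, e ∉ E → ∀ v ∈ e, v ∈ U → False := by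
    intro e he heE v hve hvU
    have hi : e ∩ U = {v} := by
      ext w
      rw [Finset.mem_inter, Finset.mem_singleton]
      constructor
      · rintro ⟨hwe, hwU⟩
        exact hT.2.eq_of_mem_of_reachable hET hU.subset (fun v hv w hw => hU.reachable hv hw) he
          heE hwe hwU hve hvU
      · rintro rfl; exact ⟨hve, hvU⟩
    have h1 := hU.attach hi (hu.card_of_mem_edges he)
    have h2 := hmax (insert e E) (by
      rw [Finset.mem_filter, Finset.mem_powerset]
      exact ⟨Finset.insert_subset he hET, _, h1⟩)
    rw [Finset.card_insert_of_notMem heE] at h2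
    omega
  have hUu : U = Finset.univ := by
    refine hT.1.eq_univ hU.root_mem fun e he v hve hvU => ?_
    by_cases heE : e ∈ E
    · exact hU.subset e heE
    · exact (hone e he heE v hve hvU).elim
  have hEe : E = T.edges := by
    refine Finset.Subset.antisymm hET fun e he => ?_
    by_contra heE
    have : e.Nonempty := by rw [← Finset.card_pos, hu.card_of_mem_edges he]; omega
    obtain ⟨v, hv⟩ := this
    exact hone e he heE v hv (hUu ▸ Finset.mem_univ v)
  rw [← hEe, ← hUu]; exact hU

end SimpleHypergraph

/-! ### Hyperpaths in the inductive sense and the standard hyperpath. -/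

section Enumeration

variable {V : Type*} [DecidableEq V]

theorem Finset.exists_image_range_eq [Nonempty V] (S : Finset V) :
    ∃ ψ : ℕ → V, (Finset.range S.card).image ψ = S := by
  induction S using Finset.induction_on with
  | empty => exact ⟨fun _ => Classical.arbitrary V, by simp⟩
  | insert a S ha ih =>
    obtain ⟨ψ, hψ⟩ := ih
    refine ⟨Function.update ψ S.card a, ?_⟩
    rw [Finset.card_insert_of_notMem ha, Finset.range_add_one, Finset.image_insert,
      Function.update_self]
    congr 1
    conv_rhs => rw [← hψ]
    refine Finset.image_congr fun i hi => ?_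
    have : i < S.card := by simpa using hi
    exact Function.update_of_ne this.ne _ _

theorem Finset.exists_image_range_eq_last (S : Finset V) {t : V} (ht : t ∈ S) {m : ℕ}
    (hS : S.card = m + 1) : ∃ ψ : ℕ → V, (Finset.range (m + 1)).image ψ = S ∧ ψ m = t := by
  have : Nonempty V := ⟨t⟩
  obtain ⟨ψ, hψ⟩ := Finset.exists_image_range_eq (S.erase t)
  rw [Finset.card_erase_of_mem ht, hS, Nat.add_sub_cancel] at hψ
  refine ⟨Function.update ψ m t, ?_, Function.update_self _ _ _⟩
  rw [Finset.range_add_one, Finset.image_insert, Function.update_self]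
  conv_rhs => rw [← Finset.insert_erase ht, ← hψ]
  congr 1
  refine Finset.image_congr fun i hi => ?_
  have : i < m := by simpa using hi
  exact Function.update_of_ne this.ne _ _

/-- Each new edge lists its fresh vertices after the old ones, with its end t last, so that the next
edge begins at the index where this one stops. Injectivity is not recorded; it is recovered by
counting in `exists_iso_hyperpath`. -/
theorem IsHyperpathOn.exists_enumeration {m : ℕ} (hm : 1 ≤ m) {r t : V} {E : Finset (Finset V)}
    {U : Finset V} (h : IsHyperpathOn m r E U t) :
    ∃ φ : ℕ → V, φ 0 = r ∧ φ (E.card * m) = t ∧ (Finset.range (E.card * m + 1)).image φ = U ∧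
      E = (Finset.range E.card).image
        fun i => (Finset.Icc (i * m) ((i + 1) * m)).image φ := by
  -- From here on m is one less than before: an edge has m + 2 vertices, of which m + 1 are fresh.
  obtain ⟨m, rfl⟩ : ∃ c, m = c + 1 := ⟨m - 1, by omega⟩
  induction h with
  | root => exact ⟨fun _ => r, by simp⟩
  | @attach E U e u t h hu hc ht htu ih =>
    obtain ⟨φ, h0, hlast, hU, hE⟩ := ih
    have hue := Finset.mem_inter.1 (by rw [hu]; simp : u ∈ e ∩ U)
    have he := h.isHypertreeOn.notMem hm hu hc
    obtain ⟨ψ, hψ, hψt⟩ := Finset.exists_image_range_eq_last (e.erase u)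
      (Finset.mem_erase.2 ⟨htu, ht⟩) (m := m) (by rw [Finset.card_erase_of_mem hue.1, hc]; omega)
    rw [Finset.card_insert_of_notMem he]
    set s := E.card with hs
    set N := s * (m + 1) with hN
    have hN1 : (s + 1) * (m + 1) = N + m + 1 := by rw [hN]; ring
    set φ' : ℕ → V := fun i => if i ≤ N then φ i else ψ (i - N - 1) with hφ'
    have hold : ∀ i, i ≤ N → φ' i = φ i := fun i hi => if_pos hi
    have hnew : ∀ i, φ' (N + 1 + i) = ψ i := fun i => by
      simp only [hφ']
      rw [if_neg (by omega)]
      congr 1; omega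
    have hnewS : (Finset.Icc (N + 1) (N + m + 1)).image φ' = e.erase u := by
      rw [← hψ]
      ext v
      simp only [Finset.mem_image, Finset.mem_Icc, Finset.mem_range]
      constructor
      · rintro ⟨i, hi, rfl⟩
        refine ⟨i - (N + 1), by omega, ?_⟩
        rw [← hnew]; congr 1; omega
      · rintro ⟨i, hi, rfl⟩
        exact ⟨N + 1 + i, by omega, hnew i⟩
    refine ⟨φ', ?_, ?_, ?_, ?_⟩
    · rw [hold 0 (by omega), h0]
    · rw [hN1, show N + m + 1 = N + 1 + m by ring, hnew, hψt]
    · rw [hN1, union_eq_union_erase hu, ← hnewS, ← hU]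
      have : Finset.range (N + m + 1 + 1) = Finset.range (N + 1) ∪
          Finset.Icc (N + 1) (N + m + 1) := by
        ext i; simp only [Finset.mem_union, Finset.mem_range, Finset.mem_Icc]; omega
      rw [this, Finset.image_union]
      congr 1
      exact Finset.image_congr fun i hi => hold i (by simpa [Nat.lt_succ_iff] using hi)
    · rw [Finset.range_add_one, Finset.image_insert]
      congr 1
      · rw [hN1, ← Finset.insert_erase hue.1, ← hnewS]
        have : Finset.Icc N (N + m + 1) = insert N (Finset.Icc (N + 1) (N + m + 1)) := by
          ext i; simp only [Finset.mem_insert, Finset.mem_Icc]; omega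
        rw [this, Finset.image_insert, hold N le_rfl, hlast]
      · conv_lhs => rw [hE]
        refine Finset.image_congr fun i hi => ?_
        have hi' : i < s := by simpa using hi
        refine Finset.image_congr fun j hj => (hold j ?_).symm
        have h1 : j ≤ (i + 1) * (m + 1) := (Finset.mem_Icc.1 (by simpa using hj)).2
        exact h1.trans (Nat.mul_le_mul_right _ hi')

end Enumeration

namespace SimpleHypergraph

universe u v

variable {V : Type u} {W : Type v}

/-- A bijection of the vertex sets under which the edge sets correspond is an isomorphism. -/
def Iso.ofImage {G : SimpleHypergraph V} {H : SimpleHypergraph W} (φ : V ≃ W)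
    (h : (fun e : Set V => φ '' e) '' G.edgeSet = H.edgeSet) : G.Iso H where
  toEquiv := φ
  image_mem_edgeSet_iff e := by
    rw [← h]
    constructor
    · rintro ⟨f, hf, hfe⟩
      have : f = e := φ.injective.image_injective hfe
      exact this ▸ hf
    · exact fun he => ⟨e, he, rfl⟩

theorem Iso.image_edgeSet {G : SimpleHypergraph V} {H : SimpleHypergraph W} (φ : G.Iso H) :
    (fun e : Set V => φ.toEquiv '' e) '' G.edgeSet = H.edgeSet := by
  ext f
  constructor
  · rintro ⟨e, he, rfl⟩
    exact (φ.image_mem_edgeSet_iff e).2 he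
  · intro hf
    have h := φ.toEquiv.image_preimage f
    refine ⟨φ.toEquiv ⁻¹' f, (φ.image_mem_edgeSet_iff _).1 (by rwa [h]), h⟩

/-- The inverse of an isomorphism. -/
def Iso.symm {G : SimpleHypergraph V} {H : SimpleHypergraph W} (φ : G.Iso H) : H.Iso G where
  toEquiv := φ.toEquiv.symm
  image_mem_edgeSet_iff e := by
    rw [← φ.image_mem_edgeSet_iff, Equiv.image_symm_eq_preimage, Equiv.image_preimage]

/-- The composition of isomorphisms. -/
def Iso.trans {X : Type*} {G : SimpleHypergraph V} {H : SimpleHypergraph W}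
    {K : SimpleHypergraph X} (φ : G.Iso H) (ψ : H.Iso K) : G.Iso K where
  toEquiv := φ.toEquiv.trans ψ.toEquiv
  image_mem_edgeSet_iff e := by
    rw [← φ.image_mem_edgeSet_iff, ← ψ.image_mem_edgeSet_iff, ← Set.image_comp]
    rfl

/-- Isomorphic pieces, glued at corresponding vertices, give isomorphic hypergraphs. -/
theorem nonempty_iso_attach {V' W' : Type*} {C : SimpleHypergraph V} {C' : SimpleHypergraph V'}
    {T : SimpleHypergraph W} {T' : SimpleHypergraph W'} (φ : C.Iso C') (ψ : T.Iso T') {c : V}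
    {c' : V'} {r : W} {r' : W'} (hc : φ.toEquiv c = c') (hr : ψ.toEquiv r = r') :
    Nonempty ((attach C c T r).Iso (attach C' c' T' r')) := by
  have hsub : ∀ w, w ≠ r ↔ ψ.toEquiv w ≠ r' := fun w => by rw [← hr]; simp
  set θ : Glued V W r ≃ Glued V' W' r' :=
    Equiv.sumCongr φ.toEquiv (ψ.toEquiv.subtypeEquiv hsub) with hθ
  have h1 : ∀ v, θ (Sum.inl v) = Sum.inl (φ.toEquiv v) := fun _ => rfl
  have h2 : ∀ w, θ (gluedInr c r w) = gluedInr c' r' (ψ.toEquiv w) := by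
    intro w
    unfold gluedInr
    by_cases hw : w = r
    · rw [dif_pos hw, dif_pos (by rw [hw, hr]), h1, hc]
    · rw [dif_neg hw, dif_neg ((hsub w).1 hw)]
      rfl
  refine ⟨Iso.ofImage θ ?_⟩
  simp only [attach]
  rw [Set.image_union, ← φ.image_edgeSet, ← ψ.image_edgeSet]
  simp only [Set.image_image, h1, h2]

/-- The `i`-th edge of the hyperpath. -/
def hyperpathEdge (k s i : ℕ) : Finset (Fin (s * (k - 1) + 1)) :=
  {w | i * (k - 1) ≤ w.val ∧ w.val ≤ (i + 1) * (k - 1)}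

theorem edges_hyperpath {k : ℕ} (hk : 3 ≤ k) (s : ℕ) :
    (hyperpath hk s).edges = (Finset.range s).image (hyperpathEdge k s) := by
  ext e
  simp only [mem_edges, hyperpath, Set.mem_range, Finset.mem_image, Finset.mem_range]
  constructor
  · rintro ⟨i, hi⟩
    exact ⟨i, i.isLt, Finset.coe_injective (by rw [← hi]; simp [hyperpathEdge])⟩
  · rintro ⟨i, hi, rfl⟩
    exact ⟨⟨i, hi⟩, by simp [hyperpathEdge]⟩

theorem hyperpath_isHyperpathOn {k : ℕ} (hk : 3 ≤ k) (s : ℕ) :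
    IsHyperpathOn (k - 1) 0 (hyperpath hk s).edges Finset.univ (Fin.last _) := by
  obtain ⟨m, rfl⟩ : ∃ m, k = m + 1 := ⟨k - 1, by omega⟩
  have hm : m + 1 - 1 = m := by omega
  -- Induction over the initial segments formed by the first j edges, inside the fixed vertex set of
  -- the whole hyperpath.
  have key : ∀ j (hj : j ≤ s), IsHyperpathOn (m + 1 - 1) (0 : Fin (s * (m + 1 - 1) + 1))
      ((Finset.range j).image (hyperpathEdge (m + 1) s)) {w | w.val ≤ j * (m + 1 - 1)}
      ⟨j * (m + 1 - 1), Nat.lt_succ_of_le (Nat.mul_le_mul_right _ hj)⟩ := by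
    simp only [hm]
    intro j
    induction j with
    | zero =>
      intro _
      convert IsHyperpathOn.root (m := m) (r := (0 : Fin (s * (m + 1 - 1) + 1))) using 1
      · simp
      · ext w
        simp only [Finset.mem_singleton, Finset.mem_filter, Finset.mem_univ, true_and, Fin.ext_iff,
          Fin.val_zero, zero_mul, Nat.le_zero]
      · ext; simp
    | succ j ih =>
      intro hj
      have hjs : (j + 1) * m ≤ s * m := Nat.mul_le_mul_right _ hj
      have hj1 : (j + 1) * m = j * m + m := Nat.succ_mul _ _
      rw [Finset.range_add_one, Finset.image_insert]
      convert (ih (by omega)).attach (e := hyperpathEdge (m + 1) s j)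
        (t := ⟨(j + 1) * m, by simp only [hm]; omega⟩) ?_ ?_ ?_ ?_ using 1
      · ext w
        simp only [hyperpathEdge, Finset.mem_union, Finset.mem_filter, Finset.mem_univ, true_and, hm]
        omega
      · ext w
        simp only [hyperpathEdge, Finset.mem_inter, Finset.mem_filter, Finset.mem_univ, true_and,
          Finset.mem_singleton, hm, Fin.ext_iff]
        omega
      · have : (hyperpathEdge (m + 1) s j).map Fin.valEmbedding =
            Finset.Icc (j * m) ((j + 1) * m) := by
          ext i
          simp only [hyperpathEdge, Finset.mem_map, Finset.mem_filter, Finset.mem_univ, true_and,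
            Fin.valEmbedding_apply, Finset.mem_Icc, hm]
          constructor
          · rintro ⟨w, hw, rfl⟩; exact hw
          · intro hi; exact ⟨⟨i, by simp only [hm]; omega⟩, hi, rfl⟩
        rw [← Finset.card_map Fin.valEmbedding, this, Nat.card_Icc]
        omega
      · simp only [hyperpathEdge, Finset.mem_filter, Finset.mem_univ, true_and, hm]
        omega
      · simp only [ne_eq, Fin.mk.injEq]; omega
  have := key s le_rfl
  rw [edges_hyperpath]
  convert this using 1
  · ext w
    have := w.isLt
    simp only [Finset.mem_univ, Finset.mem_filter, true_and, true_iff]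
    omega
  · ext; simp

theorem edges_hyperpath_card {k : ℕ} (hk : 3 ≤ k) (s : ℕ) :
    (hyperpath hk s).edges.card = s := by
  have h := (hyperpath_isHyperpathOn hk s).isHypertreeOn.card_eq (by omega)
  rw [Finset.card_univ, Fintype.card_fin] at h
  have : s * (k - 1) = (hyperpath hk s).edges.card * (k - 1) := by omega
  exact (Nat.eq_of_mul_eq_mul_right (by omega) this).symm

theorem hyperpath_isUniform {k : ℕ} (hk : 3 ≤ k) (s : ℕ) : (hyperpath hk s).IsUniform k := by
  intro e he
  have h := (hyperpath_isHyperpathOn hk s).isHypertreeOn.card_of_mem e.toFinite.toFinset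
    (by rw [mem_edges]; simpa using he)
  rw [Set.ncard_eq_toFinset_card e, h]
  omega

/-- A uniform hypergraph that is a hyperpath in the sense of `IsHyperpathOn` is isomorphic to the
standard hyperpath. -/
theorem exists_iso_hyperpath [Fintype W] [DecidableEq W] {T : SimpleHypergraph W} {k : ℕ}
    (hk : 3 ≤ k) {r t : W} (h : IsHyperpathOn (k - 1) r T.edges Finset.univ t) :
    ∃ ψ : T.Iso (hyperpath hk T.edges.card), ψ.toEquiv r = 0 := by
  obtain ⟨φ, h0, -, hU, hE⟩ := h.exists_enumeration (by omega)
  set s := T.edges.card with hs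
  set θ : Fin (s * (k - 1) + 1) → W := fun i => φ i with hθ
  have hsurj : Function.Surjective θ := by
    intro w
    have : w ∈ (Finset.range (s * (k - 1) + 1)).image φ := hU ▸ Finset.mem_univ w
    obtain ⟨i, hi, rfl⟩ := Finset.mem_image.1 this
    exact ⟨⟨i, Finset.mem_range.1 hi⟩, rfl⟩
  have hbij : Function.Bijective θ := by
    rw [Fintype.bijective_iff_surjective_and_card]
    refine ⟨hsurj, ?_⟩
    have := h.isHypertreeOn.card_eq (by omega)
    rw [Finset.card_univ] at this
    rw [Fintype.card_fin, this]
  set Θ := Equiv.ofBijective θ hbij with hΘ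
  have hiso : (fun e : Set _ => Θ '' e) '' (hyperpath hk s).edgeSet = T.edgeSet := by
    have hedge : ∀ i, i < s → Θ '' {w : Fin (s * (k - 1) + 1) |
        i * (k - 1) ≤ w.val ∧ w.val ≤ (i + 1) * (k - 1)} =
        ((Finset.Icc (i * (k - 1)) ((i + 1) * (k - 1))).image φ : Finset W) := by
      intro i hi
      have hle : (i + 1) * (k - 1) ≤ s * (k - 1) := Nat.mul_le_mul_right _ hi
      ext w
      simp only [Set.mem_image, Finset.coe_image, Finset.coe_Icc, Set.mem_Icc]
      constructor
      · rintro ⟨j, hj, rfl⟩; exact ⟨j, hj, rfl⟩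
      · rintro ⟨j, hj, rfl⟩; exact ⟨⟨j, by omega⟩, hj, rfl⟩
    ext f
    constructor
    · rintro ⟨_, ⟨i, rfl⟩, rfl⟩
      simp only
      rw [hedge i i.isLt, ← mem_edges, hE]
      exact Finset.mem_image_of_mem _ (Finset.mem_range.2 i.isLt)
    · intro hf
      have hf' : f.toFinite.toFinset ∈ T.edges := by rw [mem_edges]; simpa using hf
      rw [hE, Finset.mem_image] at hf'
      obtain ⟨i, hi, hif⟩ := hf'
      have hi' := Finset.mem_range.1 hi
      refine ⟨_, ⟨⟨i, hi'⟩, rfl⟩, ?_⟩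
      simp only
      rw [hedge i hi', hif]
      simp
  refine ⟨(Iso.ofImage Θ hiso).symm, ?_⟩
  change Θ.symm r = 0
  rw [Equiv.symm_apply_eq]
  exact h0.symm

end SimpleHypergraph

/-! ### Positive eigenvectors, and attaching at different vertices. -/

section EdgeOp

variable {V : Type*} [DecidableEq V]

theorem edgeOp_const_mul (E : Finset (Finset V)) (c : ℝ) (y : V → ℝ) (w : V) :
    edgeOp E (fun v => c * y v) w = c * edgeOp E y w := by
  simp only [edgeOp, ← Finset.mul_sum, ← mul_sub]

theorem edgeOp_pos {E : Finset (Finset V)} {y : V → ℝ} (hy : ∀ v, 0 < y v) {w : V} {e : Finset V}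
    (he : e ∈ E) (hw : w ∈ e) (hc : 2 ≤ e.card) : 0 < edgeOp E y w := by
  refine Finset.sum_pos' (fun f hf => ?_) ⟨e, Finset.mem_filter.2 ⟨he, hw⟩, ?_⟩
  · rw [Finset.mem_filter] at hf
    have := Finset.single_le_sum (fun v _ => (hy v).le) hf.2
    linarith
  · rw [← Finset.sum_erase_eq_sub hw]
    refine Finset.sum_pos (fun u _ => hy u) ?_
    rw [← Finset.card_pos, Finset.card_erase_of_mem hw]; omega

end EdgeOp

namespace SimpleHypergraph

universe u v

variable {V : Type u} {W : Type v}

section Spectral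

variable [Fintype V] {H : SimpleHypergraph V} {m : ℕ}

theorem dotProduct_adjMatrix_mulVec [DecidableEq V] (hu : H.IsUniform (m + 1)) (y : V → ℝ) :
    m * (y ⬝ᵥ (H.adjMatrix *ᵥ y)) = edgeForm H.edges y := by
  rw [← sum_mul_edgeOp_self, dotProduct, Finset.mul_sum]
  refine Finset.sum_congr rfl fun v _ => ?_
  rw [← hu.adjMatrix_mulVec]; ring

theorem edgeForm_le_rho [Nonempty V] (hu : H.IsUniform (m + 1)) (y : V → ℝ) :
    edgeForm H.edges y ≤ m * H.rho * ∑ v, y v ^ 2 := by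
  classical
  rw [← dotProduct_adjMatrix_mulVec hu, mul_assoc]
  refine mul_le_mul_of_nonneg_left ?_ (Nat.cast_nonneg m)
  have hr : H.rho = (spectralRadius ℝ H.adjMatrix).toReal := by rw [rho]
  have hsq : ∑ v, y v ^ 2 = y ⬝ᵥ y := Finset.sum_congr rfl fun v _ => sq (y v)
  rw [hr, hsq]
  exact Matrix.dotProduct_mulVec_le_spectralRadius H.adjMatrix_isSymm y

theorem edgeOp_eq_of_rho_le [Nonempty V] (hm : 1 ≤ m) [DecidableEq V] (hu : H.IsUniform (m + 1))
    (y : V → ℝ) (h : m * H.rho * ∑ v, y v ^ 2 ≤ edgeForm H.edges y) (v : V) :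
    edgeOp H.edges y v = m * H.rho * y v := by
  have hm0 : (0 : ℝ) < m := by exact_mod_cast hm
  rw [← dotProduct_adjMatrix_mulVec hu, mul_assoc] at h
  have h1 := le_of_mul_le_mul_left h hm0
  have hr : H.rho = (spectralRadius ℝ H.adjMatrix).toReal := by rw [rho]; congr!
  have h2 := Matrix.mulVec_eq_of_spectralRadius_le H.adjMatrix_isSymm y (by
    have hsq : ∑ v, y v ^ 2 = y ⬝ᵥ y := Finset.sum_congr rfl fun v _ => sq (y v)
    rwa [← hr, ← hsq])
  rw [← hu.adjMatrix_mulVec, h2, ← hr]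
  simp [mul_assoc]

theorem le_rho_of_subinvariant [Nonempty V] [DecidableEq V] (hm : 1 ≤ m)
    (hu : H.IsUniform (m + 1)) {y : V → ℝ} (hy : ∀ v, 0 < y v) {c : ℝ}
    (h : ∀ v, m * c * y v ≤ edgeOp H.edges y v) :
    c ≤ H.rho ∧ (c = H.rho → ∀ v, edgeOp H.edges y v = m * c * y v) := by
  have hm0 : (0 : ℝ) < m := by exact_mod_cast hm
  have hr : H.rho = (spectralRadius ℝ H.adjMatrix).toReal := by rw [rho]; congr!
  have h1 := Matrix.le_spectralRadius_of_subinvariant H.adjMatrix_isSymm hy (c := c) fun v => by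
    have := h v
    rw [← hu.adjMatrix_mulVec, mul_assoc] at this
    exact le_of_mul_le_mul_left this hm0
  rw [hr]
  refine ⟨h1.1, fun hc v => ?_⟩
  rw [← hu.adjMatrix_mulVec, h1.2 hc, mul_assoc]

/-- A property that is passed on along edges and holds somewhere holds everywhere. -/
def EdgeConnected (H : SimpleHypergraph V) : Prop :=
  ∀ P : V → Prop, (∀ e ∈ H.edges, ∀ v ∈ e, ∀ w ∈ e, P v → P w) → (∃ v, P v) → ∀ v, P v

/-- A uniform connected hypergraph has a positive eigenvector for its spectral radius. -/
theorem EdgeConnected.exists_pos_eigenvector [Nonempty V] [DecidableEq V]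
    (hc : H.EdgeConnected) (hu : H.IsUniform (m + 1)) :
    ∃ x : V → ℝ, (∀ v, 0 < x v) ∧ ∀ v, edgeOp H.edges x v = m * H.rho * x v := by
  obtain ⟨x, hx0, hx, hxe⟩ := Matrix.exists_nonneg_eigenvector H.adjMatrix_isSymm
    H.adjMatrix_nonneg
  have hr : H.rho = (spectralRadius ℝ H.adjMatrix).toReal := by rw [rho]; congr!
  have hop : ∀ v, edgeOp H.edges x v = m * H.rho * x v := fun v => by
    rw [← hu.adjMatrix_mulVec, hxe, ← hr]; simp [mul_assoc]
  refine ⟨x, fun v => ?_, hop⟩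
  by_contra hv
  have hv0 : x v = 0 := le_antisymm (not_lt.1 hv) (hx0 v)
  refine hx (funext (hc (fun v => x v = 0) ?_ ⟨v, hv0⟩))
  intro e he a ha b hb hxa
  have h1 := hop a
  rw [hxa, mul_zero, edgeOp, Finset.sum_eq_zero_iff_of_nonneg] at h1
  · have h2 := h1 e (Finset.mem_filter.2 ⟨he, ha⟩)
    rw [hxa, sub_zero, Finset.sum_eq_zero_iff_of_nonneg fun v _ => hx0 v] at h2
    exact h2 b hb
  · intro f hf
    have := Finset.single_le_sum (fun v _ => hx0 v) (Finset.mem_filter.1 hf).2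
    linarith

end Spectral

section Attach

variable {C : SimpleHypergraph V} {c : V} {T : SimpleHypergraph W} {r : W}

/-- `gluedInr` as an embedding. -/
noncomputable def gluedInrEmb (c : V) (r : W) : W ↪ Glued V W r :=
  ⟨gluedInr c r, gluedInr_injective c r⟩

theorem gluedInr_self (c : V) (r : W) : gluedInr c r r = Sum.inl c := by simp [gluedInr]

theorem gluedInr_of_ne (c : V) {r w : W} (h : w ≠ r) : gluedInr c r w = Sum.inr ⟨w, h⟩ := by
  simp [gluedInr, h]

theorem IsUniform.attach {k : ℕ} (hC : C.IsUniform k) (hT : T.IsUniform k) :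
    (SimpleHypergraph.attach C c T r).IsUniform k := by
  rintro _ (⟨e, he, rfl⟩ | ⟨e, he, rfl⟩)
  · rw [Set.ncard_image_of_injective _ Sum.inl_injective, hC e he]
  · rw [Set.ncard_image_of_injective _ (gluedInr_injective c r), hT e he]

theorem gluedInr_eq_inl {w : W} {v : V} (h : gluedInr c r w = Sum.inl v) : v = c := by
  unfold gluedInr at h
  split_ifs at h
  exact (Sum.inl_injective h).symm

variable [Fintype V] [Fintype W]

theorem edges_attach [Fintype (Glued V W r)] [DecidableEq (Glued V W r)] : (attach C c T r).edges =
    C.edges.map (Finset.mapEmbedding (Function.Embedding.inl)).toEmbedding ∪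
      T.edges.map (Finset.mapEmbedding (gluedInrEmb c r)).toEmbedding := by
  ext e
  simp only [mem_edges, attach, Finset.mem_union, Finset.mem_map, Set.mem_union, Set.mem_image,
    RelEmbedding.coe_toEmbedding, Finset.mapEmbedding_apply]
  refine or_congr ⟨?_, ?_⟩ ⟨?_, ?_⟩
  · rintro ⟨f, hf, hfe⟩
    refine ⟨f.toFinite.toFinset, by simpa using hf, Finset.coe_injective ?_⟩
    rw [← hfe]; simp
  · rintro ⟨f, hf, rfl⟩
    exact ⟨f, hf, by simp⟩
  · rintro ⟨f, hf, hfe⟩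
    refine ⟨f.toFinite.toFinset, by simpa using hf, Finset.coe_injective ?_⟩
    rw [← hfe]; simp [gluedInrEmb]
  · rintro ⟨f, hf, rfl⟩
    exact ⟨f, hf, by simp [gluedInrEmb]⟩

/-- The two copies share only the vertex c, while every edge has at least two vertices. Hence edge
sums on the glued hypergraph split. -/
theorem disjoint_edges_attach :
    Disjoint (C.edges.map (Finset.mapEmbedding
        (Function.Embedding.inl : V ↪ Glued V W r)).toEmbedding)
      (T.edges.map (Finset.mapEmbedding (gluedInrEmb c r)).toEmbedding) := by
  rw [Finset.disjoint_left]
  intro e he he'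
  simp only [Finset.mem_map, RelEmbedding.coe_toEmbedding, Finset.mapEmbedding_apply] at he he'
  obtain ⟨f, hf, rfl⟩ := he
  obtain ⟨f', hf', hff⟩ := he'
  have h2 := C.two_le_ncard _ (mem_edges.1 hf)
  rw [Set.ncard_coe_finset] at h2
  have hsub : f ⊆ {c} := by
    intro v hv
    have : (Sum.inl v : Glued V W r) ∈ f'.map (gluedInrEmb c r) := by
      rw [hff]; exact Finset.mem_map_of_mem _ hv
    obtain ⟨w, _, hw⟩ := Finset.mem_map.1 this
    exact Finset.mem_singleton.2 (gluedInr_eq_inl hw)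
  have := Finset.card_le_card hsub
  simp only [Finset.card_singleton] at this
  omega

variable [Fintype (Glued V W r)]

theorem edgeOp_attach_inl [DecidableEq V] [DecidableEq W] [DecidableEq (Glued V W r)] (y : Glued V W r → ℝ) (v : V) :
    edgeOp (attach C c T r).edges y (Sum.inl v) = edgeOp C.edges (y ∘ Sum.inl) v +
      if v = c then edgeOp T.edges (y ∘ gluedInr c r) r else 0 := by
  rw [edges_attach, edgeOp_union disjoint_edges_attach]
  congr 1
  · exact edgeOp_map (Function.Embedding.inl) C.edges y v
  · split_ifs with h
    · subst h
      have := edgeOp_map (gluedInrEmb v r) T.edges y r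
      rwa [show gluedInrEmb v r r = Sum.inl v from gluedInr_self v r] at this
    · refine edgeOp_map_of_notMem _ _ _ ?_
      rintro ⟨w, hw⟩
      exact h (gluedInr_eq_inl hw)

theorem edgeOp_attach_inr [DecidableEq W] [DecidableEq (Glued V W r)] (y : Glued V W r → ℝ) {w : W} (hw : w ≠ r) :
    edgeOp (attach C c T r).edges y (gluedInr c r w) = edgeOp T.edges (y ∘ gluedInr c r) w := by
  rw [edges_attach, edgeOp_union disjoint_edges_attach]
  have h1 := edgeOp_map (gluedInrEmb c r) T.edges y w
  have h2 : edgeOp (C.edges.map (Finset.mapEmbedding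
      (Function.Embedding.inl : V ↪ Glued V W r)).toEmbedding) y (gluedInr c r w) = 0 := by
    refine edgeOp_map_of_notMem _ _ _ ?_
    rintro ⟨v, hv⟩
    rw [gluedInr_of_ne c hw] at hv
    exact Sum.inl_ne_inr hv
  rw [h2, zero_add]
  exact h1

theorem edgeForm_attach (y : Glued V W r → ℝ) :
    edgeForm (attach C c T r).edges y =
      edgeForm C.edges (y ∘ Sum.inl) + edgeForm T.edges (y ∘ gluedInr c r) := by
  classical
  rw [edges_attach, edgeForm_union disjoint_edges_attach, edgeForm_map, edgeForm_map]
  rfl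

theorem EdgeConnected.attach (hC : C.EdgeConnected) (hT : T.EdgeConnected) :
    (SimpleHypergraph.attach C c T r).EdgeConnected := by
  classical
  intro P hP hex
  rw [edges_attach] at hP
  have h1 := hC (fun v => P (Sum.inl v)) fun e he v hv w hw =>
    hP _ (Finset.mem_union_left _ (Finset.mem_map_of_mem _ he)) _
      (Finset.mem_map_of_mem Function.Embedding.inl hv) _
      (Finset.mem_map_of_mem Function.Embedding.inl hw)
  have h2 := hT (fun w => P (gluedInr c r w)) fun e he v hv w hw =>
    hP _ (Finset.mem_union_right _ (Finset.mem_map_of_mem _ he)) _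
      (Finset.mem_map_of_mem (gluedInrEmb c r) hv) _
      (Finset.mem_map_of_mem (gluedInrEmb c r) hw)
  have hc : P (Sum.inl c) := by
    obtain ⟨v | w, hz⟩ := hex
    · exact h1 ⟨v, hz⟩ c
    · rw [← gluedInr_self c r]
      exact h2 ⟨w.1, by rw [gluedInr_of_ne c w.2]; exact hz⟩ r
  rintro (v | w)
  · exact h1 ⟨c, hc⟩ v
  · have := h2 ⟨r, by rw [gluedInr_self]; exact hc⟩ w.1
    rwa [gluedInr_of_ne c w.2] at this

/-- If every edge of `C` at `a` contains `v`, but not conversely, then attaching at `v` gives a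
larger spectral radius than attaching at `a`. -/
theorem rho_attach_lt_rho_attach {m : ℕ} (hm : 1 ≤ m) (hC : C.IsUniform (m + 1))
    (hT : T.IsUniform (m + 1)) {a v : V} (hconn : (attach C a T r).EdgeConnected)
    (hav : ∀ e ∈ C.edges, a ∈ e → v ∈ e) (hva : ∃ e ∈ C.edges, v ∈ e ∧ a ∉ e)
    (hr : ∃ e ∈ T.edges, r ∈ e) : (attach C a T r).rho < (attach C v T r).rho := by
  classical
  have hne : Nonempty (Glued V W r) := ⟨Sum.inl a⟩
  have hm0 : (0 : ℝ) < m := by exact_mod_cast hm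
  have hua := hC.attach (c := a) (r := r) hT
  have huv := hC.attach (c := v) (r := r) hT
  obtain ⟨x, hx0, hx⟩ := hconn.exists_pos_eigenvector hua
  obtain ⟨e₀, he₀, hve₀, hae₀⟩ := hva
  have hne' : v ≠ a := fun h => hae₀ (h ▸ hve₀)
  obtain ⟨e₁, he₁, hre₁⟩ := hr
  have hΛ : m * (attach C a T r).rho * ∑ z, x z ^ 2 = edgeForm (attach C a T r).edges x := by
    rw [← sum_mul_edgeOp_self, Finset.mul_sum]
    refine Finset.sum_congr rfl fun z _ => ?_
    rw [hx]; ring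
  have hsq : 0 < ∑ z, x z ^ 2 := Finset.sum_pos (fun z _ => pow_pos (hx0 z) 2)
    Finset.univ_nonempty
  rw [edgeForm_attach] at hΛ
  -- If x is at least as large at v as at a, x itself is a test vector after `T` is moved to v.
  -- Otherwise the values at a and v are exchanged, so that `T` sees the same values as before and
  -- only the form on `C` changes.
  rcases le_or_gt (x (Sum.inl a)) (x (Sum.inl v)) with hle | hlt
  · by_contra hcon
    rw [not_lt] at hcon
    have hupd : x ∘ gluedInr v r = Function.update (x ∘ gluedInr a r) r (x (Sum.inl v)) := by
      ext w
      by_cases hw : w = r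
      · subst hw; simp [gluedInr_self]
      · simp [Function.update_of_ne hw, gluedInr_of_ne _ hw]
    have hform : edgeForm (attach C v T r).edges x = edgeForm C.edges (x ∘ Sum.inl) +
        (edgeForm T.edges (x ∘ gluedInr a r) + 2 * (x (Sum.inl v) - x (Sum.inl a)) *
          edgeOp T.edges (x ∘ gluedInr a r) r) := by
      rw [edgeForm_attach, hupd, edgeForm_update]
      simp [gluedInr_self]
    have hnn := edgeOp_nonneg T.edges (y := x ∘ gluedInr a r) (fun w => (hx0 _).le) r
    have hge : 0 ≤ 2 * (x (Sum.inl v) - x (Sum.inl a)) * edgeOp T.edges (x ∘ gluedInr a r) r :=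
      mul_nonneg (by linarith) hnn
    have hρ : m * (attach C v T r).rho ≤ m * (attach C a T r).rho :=
      mul_le_mul_of_nonneg_left hcon hm0.le
    have hρ' := mul_le_mul_of_nonneg_right hρ hsq.le
    -- If the radius did not grow, x would be an eigenvector for both hypergraphs; but the edge sum
    -- at v has gained the positive contribution of `T`.
    have h1 := edgeOp_eq_of_rho_le hm huv x (by linarith) (Sum.inl v)
    have h2 := hx (Sum.inl v)
    rw [edgeOp_attach_inl, if_pos rfl] at h1
    rw [edgeOp_attach_inl, if_neg hne'] at h2
    have h3 : 0 < edgeOp T.edges (x ∘ gluedInr v r) r :=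
      edgeOp_pos (fun w => hx0 _) he₁ hre₁ (by rw [hT.card_of_mem_edges he₁]; omega)
    have h4 := mul_le_mul_of_nonneg_right hρ (hx0 (Sum.inl v)).le
    linarith
  · have hsw := edgeForm_lt_swap (E := C.edges) (y := x ∘ Sum.inl) (fun u => hx0 _) (a := a)
      (v := v) hlt hav he₀ hve₀ hae₀ (by rw [hC.card_of_mem_edges he₀]; omega)
    set σ : Equiv.Perm (Glued V W r) := Equiv.swap (Sum.inl a) (Sum.inl v) with hσ
    have h1 : (x ∘ σ) ∘ Sum.inl = (x ∘ Sum.inl) ∘ Equiv.swap a v := by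
      ext u
      simp only [Function.comp]
      congr 1
      exact (Function.Injective.map_swap (f := (Sum.inl : V → Glued V W r)) Sum.inl_injective a v u).symm
    have h2 : (x ∘ σ) ∘ gluedInr v r = x ∘ gluedInr a r := by
      ext w
      simp only [Function.comp]
      by_cases hw : w = r
      · subst hw
        rw [gluedInr_self, gluedInr_self, hσ, Equiv.swap_apply_right]
      · rw [gluedInr_of_ne _ hw, gluedInr_of_ne _ hw, hσ,
          Equiv.swap_apply_of_ne_of_ne Sum.inr_ne_inl Sum.inr_ne_inl]
    have h3 := edgeForm_le_rho huv (x ∘ σ)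
    rw [edgeForm_attach, h1, h2] at h3
    have h4 : ∑ z, (x ∘ σ) z ^ 2 = ∑ z, x z ^ 2 := Equiv.sum_comp σ fun z => x z ^ 2
    rw [h4] at h3
    have h5 : m * (attach C a T r).rho * ∑ z, x z ^ 2 <
        m * (attach C v T r).rho * ∑ z, x z ^ 2 := by linarith
    exact lt_of_mul_lt_mul_left (lt_of_mul_lt_mul_right h5 hsq.le) hm0.le

end Attach

/-! ### The hypercycle: uniformity, lower bounds for its radius, automorphisms. -/

section Cyclic

theorem cyclicSucc_ne {g : ℕ} (hg : 2 ≤ g) (i : Fin g) : cyclicSucc i ≠ i := by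
  intro h
  have h1 := congrArg Fin.val h
  simp only [cyclicSucc] at h1
  rcases Nat.lt_or_ge (i.val + 1) g with h2 | h2
  · rw [Nat.mod_eq_of_lt h2] at h1; omega
  · have : i.val + 1 = g := by omega
    rw [this, Nat.mod_self] at h1; omega

theorem cyclicSucc_eq_add_one {g : ℕ} [NeZero g] (i : Fin g) : cyclicSucc i = i + 1 := by
  ext
  simp [cyclicSucc, Fin.val_add]

theorem cyclicSucc_injective {g : ℕ} : Function.Injective (cyclicSucc : Fin g → Fin g) := by
  intro i j h
  have : NeZero g := ⟨by have := i.isLt; omega⟩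
  rw [cyclicSucc_eq_add_one, cyclicSucc_eq_add_one] at h
  exact add_right_cancel h

theorem forall_of_cyclicSucc {g : ℕ} {P : Fin g → Prop} (h : ∀ i, P i → P (cyclicSucc i))
    (hex : ∃ i, P i) (j : Fin g) : P j := by
  obtain ⟨i, hi⟩ := hex
  have key : ∀ t : ℕ, P ⟨(i.val + t) % g, Nat.mod_lt _ (by have := i.isLt; omega)⟩ := by
    intro t
    induction t with
    | zero =>
      convert hi
      exact Nat.mod_eq_of_lt i.isLt
    | succ t ih =>
      convert h _ ih using 1
      simp only [cyclicSucc, Fin.mk.injEq, Nat.mod_add_mod]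
      rfl
  -- Going from i to j in g - i + j steps avoids a case distinction on their order.
  convert key (g - i.val + j.val)
  have : i.val + (g - i.val + j.val) = g + j.val := by have := i.isLt; omega
  rw [this, Nat.add_mod_left, Nat.mod_eq_of_lt j.isLt]

end Cyclic

section Hypercycle

variable {g k : ℕ}

/-- The `i`-th edge of the hypercycle. -/
def hypercycleEdge (g k : ℕ) (i : Fin g) : Finset (Fin g × Fin (k - 1)) :=
  {p | p.1 = i ∨ (p.1 = cyclicSucc i ∧ p.2.val = 0)}

theorem mem_hypercycleEdge {i : Fin g} {p : Fin g × Fin (k - 1)} :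
    p ∈ hypercycleEdge g k i ↔ p.1 = i ∨ (p.1 = cyclicSucc i ∧ p.2.val = 0) := by
  simp [hypercycleEdge]

theorem edges_hypercycle (hk : 3 ≤ k) :
    (hypercycle g hk).edges = Finset.univ.image (hypercycleEdge g k) := by
  ext e
  simp only [mem_edges, hypercycle, Set.mem_range, Finset.mem_image, Finset.mem_univ, true_and]
  constructor
  · rintro ⟨i, hi⟩
    exact ⟨i, Finset.coe_injective (by rw [← hi]; simp [hypercycleEdge])⟩
  · rintro ⟨i, rfl⟩
    exact ⟨i, by simp [hypercycleEdge]⟩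

theorem hypercycleEdge_injective (hk : 3 ≤ k) : Function.Injective (hypercycleEdge g k) := by
  intro i j h
  have h1 : ((i, ⟨1, by omega⟩) : Fin g × Fin (k - 1)) ∈ hypercycleEdge g k i :=
    mem_hypercycleEdge.2 (Or.inl rfl)
  rw [h, mem_hypercycleEdge] at h1
  simpa using h1

theorem sum_hypercycleEdge (hk : 3 ≤ k) (hg : 2 ≤ g) {M : Type*} [AddCommMonoid M]
    (f : Fin g × Fin (k - 1) → M) (i : Fin g) :
    ∑ p ∈ hypercycleEdge g k i, f p =
      ∑ j, f (i, j) + f (cyclicSucc i, ⟨0, by omega⟩) := by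
  have h : hypercycleEdge g k i = insert (cyclicSucc i, ⟨0, by omega⟩)
      (Finset.univ.map ⟨fun j => (i, j), fun _ _ h => (Prod.mk.inj h).2⟩) := by
    ext p
    simp only [mem_hypercycleEdge, Finset.mem_insert, Finset.mem_map, Finset.mem_univ, true_and,
      Prod.ext_iff, Fin.ext_iff]
    constructor
    · rintro (h | h)
      · exact Or.inr ⟨p.2, h.symm, rfl⟩
      · exact Or.inl h
    · rintro (h | ⟨_, h, _⟩)
      · exact Or.inr h
      · exact Or.inl h.symm
  rw [h, Finset.sum_insert, Finset.sum_map, add_comm]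
  · rfl
  · simp only [Finset.mem_map, Finset.mem_univ, true_and, not_exists]
    intro j hj
    exact cyclicSucc_ne hg i (Prod.mk.inj hj).1.symm

theorem hypercycle_isUniform (hk : 3 ≤ k) (hg : 2 ≤ g) : (hypercycle g hk).IsUniform k := by
  intro e he
  have h : e.toFinite.toFinset ∈ (hypercycle g hk).edges := by rw [mem_edges]; simpa using he
  rw [edges_hypercycle, Finset.mem_image] at h
  obtain ⟨i, -, hi⟩ := h
  rw [Set.ncard_eq_toFinset_card e, ← hi, Finset.card_eq_sum_ones, sum_hypercycleEdge hk hg]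
  simp only [Finset.sum_const, Finset.card_univ, Fintype.card_fin, smul_eq_mul]
  omega

theorem hypercycle_edgeConnected (hk : 3 ≤ k) : (hypercycle g hk).EdgeConnected := by
  intro P hP hex
  have hE : ∀ i, ∀ v ∈ hypercycleEdge g k i, ∀ w ∈ hypercycleEdge g k i, P v → P w := fun i =>
    hP _ (by rw [edges_hypercycle]; exact Finset.mem_image_of_mem _ (Finset.mem_univ i))
  have h0 : ∀ i, P (i, ⟨0, by omega⟩) := by
    refine forall_of_cyclicSucc (fun i hi => ?_) ?_
    · exact hE i _ (mem_hypercycleEdge.2 (Or.inl rfl)) _ (mem_hypercycleEdge.2 (Or.inr ⟨rfl, rfl⟩))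
        hi
    · obtain ⟨⟨i, j⟩, h⟩ := hex
      exact ⟨i, hE i _ (mem_hypercycleEdge.2 (Or.inl rfl)) _ (mem_hypercycleEdge.2 (Or.inl rfl)) h⟩
  rintro ⟨i, j⟩
  exact hE i _ (mem_hypercycleEdge.2 (Or.inl rfl)) _ (mem_hypercycleEdge.2 (Or.inl rfl)) (h0 i)

/-- Bounds for `Λ` if the hypercycle has a positive vector with `edgeOp x ≤ Λ x`. -/
theorem hypercycle_bounds (hk : 3 ≤ k) (hg : 2 ≤ g) {x : Fin g × Fin (k - 1) → ℝ}
    (hx0 : ∀ v, 0 < x v) {Λ : ℝ} (hx : ∀ v, edgeOp (hypercycle g hk).edges x v ≤ Λ * x v) {m : ℕ}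
    (hm : k = m + 1) :
    (m : ℝ) < Λ ∧ 4 * (Λ + 1) ≤ (Λ + 2) * (Λ - m + 2) := by
  subst hm
  have hg0 : 0 < g := by omega
  set z : Fin (m + 1 - 1) := ⟨0, by omega⟩ with hz
  set X := ∑ v, x v with hX
  set X₀ := ∑ i, x (i, z) with hX0
  have hXsum : X = ∑ i, ∑ j, x (i, j) := Fintype.sum_prod_type _
  have hsucc : ∑ i, x (cyclicSucc i, z) = X₀ :=
    (Finite.injective_iff_bijective.1 cyclicSucc_injective).sum_comp fun i => x (i, z)
  have hX0pos : 0 < X₀ := Finset.sum_pos (fun i _ => hx0 _) ⟨⟨0, hg0⟩, Finset.mem_univ _⟩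
  have hX0le : X₀ ≤ X := by
    rw [hXsum]
    exact Finset.sum_le_sum fun i _ =>
      Finset.single_le_sum (f := fun j => x (i, j)) (fun j _ => (hx0 _).le) (Finset.mem_univ z)
  have hm2 : (2 : ℝ) ≤ m := by exact_mod_cast (by omega : 2 ≤ m)
  -- The hypothesis is paired with weights 1 at the cut vertices and η at the inner ones. An edge
  -- has weight η (m - 1) + 2, and X + X₀ is the sum of x over all edges, because each cut vertex
  -- lies in two of them.
  have main : ∀ η : ℝ, 0 ≤ η → (η * (m - 1) + 2) * (X + X₀) - (η * (X + X₀) + (1 - η) * (2 * X₀)) ≤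
      Λ * (η * X + (1 - η) * X₀) := by
    intro η hη
    set φ : Fin g × Fin (m + 1 - 1) → ℝ := fun p => η + (1 - η) * if p.2 = z then 1 else 0 with hφ
    have hφ0 : ∀ v, 0 ≤ φ v := fun v => by
      simp only [hφ]; split_ifs <;> linarith
    have hsum : ∑ v, φ v * edgeOp (hypercycle g hk).edges x v ≤ ∑ v, φ v * (Λ * x v) :=
      Finset.sum_le_sum fun v _ => mul_le_mul_of_nonneg_left (hx v) (hφ0 v)
    have hR : ∑ v, φ v * (Λ * x v) = Λ * (η * X + (1 - η) * X₀) := by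
      have : ∀ v, φ v * (Λ * x v) = Λ * η * x v + Λ * (1 - η) * if v.2 = z then x v else 0 := by
        intro v; simp only [hφ]; split_ifs <;> ring
      simp only [this, Finset.sum_add_distrib, ← Finset.mul_sum]
      rw [Fintype.sum_prod_type (fun v : Fin g × Fin (m + 1 - 1) => if v.2 = z then x v else 0)]
      simp only [Finset.sum_ite_eq', Finset.mem_univ, if_true]
      ring
    rw [sum_mul_edgeOp, hR, edges_hypercycle,
      Finset.sum_image fun _ _ _ _ h => hypercycleEdge_injective hk h] at hsum
    have hS : ∀ i, ∑ v ∈ hypercycleEdge g (m + 1) i, φ v = η * (m - 1) + 2 := by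
      intro i
      rw [sum_hypercycleEdge hk hg]
      simp only [hφ, Finset.sum_add_distrib, ← Finset.mul_sum, Finset.sum_ite_eq',
        Finset.mem_univ, if_true, Finset.sum_const, Finset.card_univ, Fintype.card_fin,
        nsmul_eq_mul, Nat.add_sub_cancel, ← hz]
      ring
    have hxφ : ∀ i, ∑ v ∈ hypercycleEdge g (m + 1) i, φ v * x v =
        η * (∑ j, x (i, j) + x (cyclicSucc i, z)) +
          (1 - η) * (x (i, z) + x (cyclicSucc i, z)) := by
      intro i
      have : ∀ v, φ v * x v = η * x v + (1 - η) * if v.2 = z then x v else 0 := by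
        intro v; simp only [hφ]; split_ifs <;> ring
      rw [sum_hypercycleEdge hk hg]
      simp only [this, Finset.sum_add_distrib, ← Finset.mul_sum, Finset.sum_ite_eq',
        Finset.mem_univ, if_true, ← hz]
      ring
    simp only [hS, hxφ, sum_hypercycleEdge hk hg x, Finset.sum_sub_distrib, ← Finset.mul_sum,
      Finset.sum_add_distrib, ← hz, hsucc, ← hXsum, ← hX0] at hsum
    linarith
  have h1 := main 1 zero_le_one
  have hΛ : (m : ℝ) < Λ := by
    by_contra hcon
    rw [not_lt] at hcon
    have := mul_le_mul_of_nonneg_right hcon (hX0pos.le.trans hX0le)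
    nlinarith
  refine ⟨hΛ, ?_⟩
  set F := Λ - m + 2 with hF
  have hF0 : 0 < F := by simp only [hF]; linarith
  -- The weight 2 / F makes the symmetric weight vector satisfy the eigenvalue equation at inner
  -- vertices, so X - X₀ cancels and an inequality in Λ alone remains.
  have h2 := main (2 / F) (by positivity)
  have h3 : Λ * (2 / F) = 2 + (m - 2) * (2 / F) := by field_simp; simp only [hF]; ring
  set η := 2 / F with hη
  have h4 : (2 + 2 * (m - 1) * η) * X₀ ≤ Λ * X₀ := by
    linear_combination h2 + (X - X₀) * h3
  have h5 := le_of_mul_le_mul_right h4 hX0pos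
  have h6 := mul_le_mul_of_nonneg_right h5 hF0.le
  have h7 : η * F = 2 := by rw [hη]; field_simp
  have h8 : (2 + 2 * (m - 1) * η) * F = 2 * F + 4 * (m - 1) := by
    linear_combination (2 * ((m : ℝ) - 1)) * h7
  rw [h8] at h6
  linarith

/-- Any vertex of the hypercycle is equivalent to one of the two standard vertices under an
automorphism. -/
theorem exists_hypercycle_iso (hk : 3 ≤ k) (hg : 2 ≤ g) (c : Fin g × Fin (k - 1)) :
    ∃ φ : (hypercycle g hk).Iso (hypercycle g hk), φ.toEquiv c = cycleVertex hk hg ∨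
      φ.toEquiv c = cycleInnerVertex hk hg := by
  have : NeZero g := ⟨by omega⟩
  set z : Fin (k - 1) := ⟨0, by omega⟩ with hz
  set o : Fin (k - 1) := ⟨1, by omega⟩ with ho
  -- The automorphism is a rotation of the edges combined with one permutation of positions in each
  -- edge that fixes the cut vertex.
  obtain ⟨σ, hσz, hσc⟩ : ∃ σ : Equiv.Perm (Fin (k - 1)), σ z = z ∧ (σ c.2 = z ∨ σ c.2 = o) := by
    by_cases hc : c.2 = z
    · exact ⟨Equiv.refl _, rfl, Or.inl hc⟩
    · exact ⟨Equiv.swap c.2 o, Equiv.swap_apply_of_ne_of_ne (Ne.symm hc) (by simp [hz, ho]),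
        Or.inr (Equiv.swap_apply_left _ _)⟩
  set τ : Equiv.Perm (Fin g) := Equiv.subRight c.1 with hτ
  have hτs : ∀ i, τ (cyclicSucc i) = cyclicSucc (τ i) := by
    intro i
    simp only [hτ, Equiv.subRight_apply, cyclicSucc_eq_add_one]
    abel
  have himg : ∀ i, Equiv.prodCongr τ σ '' {p : Fin g × Fin (k - 1) | p.1 = i ∨
      (p.1 = cyclicSucc i ∧ p.2.val = 0)} = {p : Fin g × Fin (k - 1) | p.1 = τ i ∨
      (p.1 = cyclicSucc (τ i) ∧ p.2.val = 0)} := by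
    intro i
    have hval : ∀ j : Fin (k - 1), j.val = 0 ↔ j = z := fun j => by simp [hz, Fin.ext_iff]
    ext p
    rw [Equiv.image_eq_preimage_symm]
    simp only [Set.mem_preimage, Set.mem_ofPred_eq, hval,
      Equiv.prodCongr_symm, Equiv.prodCongr_apply, Prod.map_fst, Prod.map_snd,
      Equiv.symm_apply_eq, hτs, hσz]
  refine ⟨Iso.ofImage (Equiv.prodCongr τ σ) ?_, ?_⟩
  · simp only [hypercycle]
    rw [← Set.range_comp]
    simp only [Function.comp_def, himg]
    exact τ.surjective.range_comp fun i => {p : Fin g × Fin (k - 1) | p.1 = i ∨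
      (p.1 = cyclicSucc i ∧ p.2.val = 0)}
  · have h1 : τ c.1 = ⟨0, by omega⟩ := by simp [hτ]
    change (τ c.1, σ c.2) = _ ∨ (τ c.1, σ c.2) = _
    rw [h1]
    rcases hσc with h | h
    · exact Or.inl (by rw [h]; rfl)
    · exact Or.inr (by rw [h]; rfl)

end Hypercycle

/-! ### Comparison with the lollipops and conclusion. -/

variable {g k : ℕ}

theorem hyperpath_edgeConnected (hk : 3 ≤ k) (s : ℕ) : (hyperpath hk s).EdgeConnected :=
  fun _ hP ⟨v, hv⟩ w => (hyperpath_isHyperpathOn hk s).isHypertreeOn.forall_of_exists hP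
    ⟨v, Finset.mem_univ v, hv⟩ w (Finset.mem_univ w)

/-- Among the supertrees with a given number of edges, attached at a fixed vertex of the hypercycle,
the hyperpath attached by its end is the unique one of minimal spectral radius. -/
theorem rho_attach_hyperpath_le (hk : 3 ≤ k) (hg : 2 ≤ g) (c : Fin g × Fin (k - 1)) [Fintype W]
    {T : SimpleHypergraph W} {r : W} (hT : T.IsSupertree) (hu : T.IsUniform k)
    [Fintype (Glued (Fin g × Fin (k - 1)) W r)] :
    (attach (hypercycle g hk) c (hyperpath hk T.edges.card) 0).rho ≤
        (attach (hypercycle g hk) c T r).rho ∧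
      ((attach (hypercycle g hk) c (hyperpath hk T.edges.card) 0).rho =
        (attach (hypercycle g hk) c T r).rho →
        ∃ ψ : T.Iso (hyperpath hk T.edges.card), ψ.toEquiv r = 0) := by
  classical
  obtain ⟨m, hm, hkm⟩ : ∃ m, 2 ≤ m ∧ k = m + 1 := ⟨k - 1, by omega, by omega⟩
  have hm1 : 1 ≤ m := by omega
  have hk1 : k - 1 = m := by omega
  set s := T.edges.card with hs
  have hCu := hypercycle_isUniform hk hg
  have hPu := hyperpath_isUniform hk s
  have hLu := hCu.attach (c := c) (r := 0) hPu
  have hGu := hCu.attach (c := c) (r := r) hu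
  have hconn := (hypercycle_edgeConnected (g := g) hk).attach (c := c) (r := 0)
    (hyperpath_edgeConnected hk s)
  have : Nonempty (Glued (Fin g × Fin (k - 1)) (Fin (s * (k - 1) + 1)) 0) := ⟨Sum.inl c⟩
  have : Nonempty (Glued (Fin g × Fin (k - 1)) W r) := ⟨Sum.inl c⟩
  obtain ⟨x, hx0, hx⟩ := hconn.exists_pos_eigenvector (m := m) (by rw [← hkm]; exact hLu)
  set ρ := (attach (hypercycle g hk) c (hyperpath hk s) 0).rho with hρ
  set Λ : ℝ := m * ρ with hΛ
  set xC := x ∘ (Sum.inl : _ → Glued (Fin g × Fin (k - 1)) (Fin (s * (k - 1) + 1)) 0) with hxC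
  set xP := x ∘ gluedInr c (0 : Fin (s * (k - 1) + 1)) with hxP
  have hxP0 : xP 0 = xC c := by simp [hxP, hxC, gluedInr_self]
  have hCx : ∀ v, edgeOp (hypercycle g hk).edges xC v +
      (if v = c then edgeOp (hyperpath hk s).edges xP 0 else 0) = Λ * xC v := fun v => by
    rw [← edgeOp_attach_inl, hx]; rfl
  have hPx : ∀ w, w ≠ 0 → edgeOp (hyperpath hk s).edges xP w = Λ * xP w := fun w hw => by
    rw [hxP, ← edgeOp_attach_inr _ hw, hx]; rfl
  -- Dropping the nonnegative contribution of the hyperpath at c leaves an inequality on the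
  -- hypercycle.
  obtain ⟨hb1, hb2⟩ := hypercycle_bounds hk hg (x := xC) (fun v => hx0 _) (Λ := Λ) (m := m)
    (fun v => by
      rw [← hCx v]
      have := edgeOp_nonneg (hyperpath hk s).edges (y := xP) (fun w => (hx0 _).le) 0
      split_ifs <;> linarith) hkm
  obtain ⟨α, hα⟩ := exists_isResponse hm hb1 hb2
  have hpath := hyperpath_isHyperpathOn hk s
  have hα' : IsResponse (k - 1) (Λ + 1) α := by rw [hk1]; exact hα
  obtain ⟨y, hy0, hyr, hy⟩ := hpath.exists_invariant (by omega) hα' (fun _ => 0) (fun _ _ _ => rfl)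
  simp only [Finset.sum_const_zero, add_zero, edges_hyperpath_card, hα.zero, zero_mul,
    Finset.mem_univ, true_implies, add_sub_cancel_right] at hy
  -- Both `xP` and `y` satisfy the equations with Λ off the root. In the symmetric pairing of the
  -- two all other terms cancel, so their relative edge sums at the root agree.
  have hresp : edgeOp (hyperpath hk s).edges xP 0 = α s * xP 0 := by
    have h1 := sum_mul_edgeOp_comm (hyperpath hk s).edges xP y
    rw [← sub_eq_zero, ← Finset.sum_sub_distrib, Finset.sum_eq_single 0] at h1
    · rw [← hy 0, if_pos rfl, hyr] at h1
      linarith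
    · intro w _ hw
      rw [← hy w, if_neg hw, hPx w hw]; ring
    · simp
  rw [hresp, hxP0] at hCx
  have htree := hT.isHypertreeOn hm1 (hkm ▸ hu) r
  obtain ⟨yT, hyT0, hyTr, hyT, hyTeq⟩ := htree.exists_subinvariant hm1 hα (fun _ => 0)
  simp only [Finset.sum_const_zero, add_zero, hα.zero, zero_mul,
    Finset.mem_univ, true_implies, add_sub_cancel_right, ← hs] at hyT hyTeq
  -- The two vectors are matched at the common vertex, where `yT` equals 1.
  set Y : Glued (Fin g × Fin (k - 1)) W r → ℝ := Sum.elim xC (fun w => xC c * yT w) with hY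
  have hxc : 0 < xC c := hx0 _
  have hYC : Y ∘ Sum.inl = xC := rfl
  have hYT : Y ∘ gluedInr c r = fun w => xC c * yT w := by
    ext w
    by_cases hw : w = r
    · subst hw; simp [gluedInr_self, hY, hyTr]
    · simp [gluedInr_of_ne c hw, hY]
  have hYinl : ∀ v, edgeOp (attach (hypercycle g hk) c T r).edges Y (Sum.inl v) =
      edgeOp (hypercycle g hk).edges xC v + if v = c then xC c * edgeOp T.edges yT r else 0 := by
    intro v
    rw [edgeOp_attach_inl, hYC, hYT, edgeOp_const_mul]
  have hYinr : ∀ w, w ≠ r → edgeOp (attach (hypercycle g hk) c T r).edges Y (gluedInr c r w) =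
      xC c * edgeOp T.edges yT w := by
    intro w hw
    rw [edgeOp_attach_inr _ hw, hYT, edgeOp_const_mul]
  have hYw : ∀ w, Y (gluedInr c r w) = xC c * yT w := fun w => congrFun hYT w
  have hroot := hyT r
  rw [if_pos rfl, hyTr, mul_one] at hroot
  have hmain := le_rho_of_subinvariant hm1 (H := attach (hypercycle g hk) c T r)
    (by rw [← hkm]; exact hGu) (y := Y) (c := ρ) (by
      rintro (v | w)
      · exact hx0 _
      · exact mul_pos hxc (hyT0 _)) (by
      rintro (v | w)
      · rw [hYinl]
        change Λ * xC v ≤ _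
        rw [← hCx v]
        split_ifs
        · have := mul_le_mul_of_nonneg_left hroot hxc.le
          linarith
        · exact le_rfl
      · rw [← gluedInr_of_ne c w.2, hYinr _ w.2, hYw]
        have := hyT w.1
        rw [if_neg w.2] at this
        have := mul_le_mul_of_nonneg_left this hxc.le
        change Λ * _ ≤ _
        linarith)
  refine ⟨hmain.1, fun heq => ?_⟩
  have hall := hmain.2 heq
  -- Equal radii make `Y` an eigenvector. Restricted to `T` this gives all equalities required,
  -- including the one at the root, since the hypercycle contributes the same at c on both sides.
  obtain ⟨t, ht, -⟩ := hyTeq fun w => by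
    by_cases hw : w = r
    · subst hw
      have h1 := hall (Sum.inl c)
      rw [hYinl, if_pos rfl] at h1
      change _ = Λ * xC c at h1
      rw [← hCx c, if_pos rfl] at h1
      rw [if_pos rfl, hyTr, mul_one]
      apply mul_left_cancel₀ hxc.ne'
      linarith
    · have h1 := hall (gluedInr c r w)
      rw [hYinr w hw, hYw] at h1
      rw [if_neg hw]
      apply mul_left_cancel₀ hxc.ne'
      rw [h1, hΛ]; ring
  exact exists_iso_hyperpath hk (by rw [hk1]; exact ht)

/-- The identity isomorphism. -/
def Iso.refl (G : SimpleHypergraph V) : G.Iso G where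
  toEquiv := Equiv.refl V
  image_mem_edgeSet_iff e := by simp

theorem card_glued_hypercycle (hk : 3 ≤ k) [Fintype W] {T : SimpleHypergraph W} (r : W)
    (hT : T.IsSupertree) (hu : T.IsUniform k) [Fintype (Glued (Fin g × Fin (k - 1)) W r)] :
    Fintype.card (Glued (Fin g × Fin (k - 1)) W r) = (g + T.edges.card) * (k - 1) := by
  classical
  obtain ⟨m, rfl⟩ : ∃ m, k = m + 1 := ⟨k - 1, by omega⟩
  have h := (hT.isHypertreeOn (by omega) hu r).card_eq (by omega)
  rw [Finset.card_univ] at h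
  rw [← Nat.card_eq_fintype_card, Nat.card_sum, Nat.card_eq_fintype_card,
    Nat.card_eq_fintype_card, Fintype.card_subtype_compl, Fintype.card_subtype_eq, h,
    Fintype.card_prod, Fintype.card_fin, Fintype.card_fin, Nat.add_sub_cancel, Nat.add_sub_cancel]
  ring

theorem minimal_of_iso_attach [Fintype V] {G : SimpleHypergraph V} (hk : 3 ≤ k) (hg : 2 ≤ g)
    {c : Fin g × Fin (k - 1)} [Fintype W] {T : SimpleHypergraph W} {r : W} (hT : T.IsSupertree)
    (hu : T.IsUniform k) (φ : G.Iso (attach (hypercycle g hk) c T r)) :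
    (T.edges.card : ℚ) = (Fintype.card V : ℚ) / ((k : ℚ) - 1) - (g : ℚ) ∧
      (attach (hypercycle g hk) c (hyperpath hk T.edges.card) 0).rho ≤ G.rho ∧
      ((attach (hypercycle g hk) c (hyperpath hk T.edges.card) 0).rho = G.rho ↔
        Nonempty (G.Iso (attach (hypercycle g hk) c (hyperpath hk T.edges.card) 0))) := by
  classical
  have hmain := rho_attach_hyperpath_le hk hg c (r := r) hT hu
  rw [← φ.rho_eq] at hmain
  refine ⟨?_, hmain.1, fun h => ?_, fun ⟨ψ⟩ => ψ.rho_eq.symm⟩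
  · rw [Fintype.card_congr φ.toEquiv, card_glued_hypercycle hk r hT hu]
    have hk1 : ((k - 1 : ℕ) : ℚ) = (k : ℚ) - 1 := by rw [Nat.cast_sub (by omega)]; simp
    have hk0 : (k : ℚ) - 1 ≠ 0 := by rw [← hk1]; exact_mod_cast (by omega : k - 1 ≠ 0)
    push_cast
    rw [hk1, mul_div_assoc, div_self hk0]
    ring
  · obtain ⟨ψ, hψ⟩ := hmain.2 h
    obtain ⟨θ⟩ := nonempty_iso_attach (Iso.refl (hypercycle g hk)) ψ (c := c) rfl hψ
    exact ⟨φ.trans θ⟩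

theorem IsOctopuslikeAt.minimal [Fintype V] {G : SimpleHypergraph V} (hk : 3 ≤ k) (hg : 2 ≤ g)
    {c : Fin g × Fin (k - 1)} (h : G.IsOctopuslikeAt hk c) :
    ∃ s : ℕ, (s : ℚ) = (Fintype.card V : ℚ) / ((k : ℚ) - 1) - (g : ℚ) ∧
      (attach (hypercycle g hk) c (hyperpath hk s) 0).rho ≤ G.rho ∧
      ((attach (hypercycle g hk) c (hyperpath hk s) 0).rho = G.rho ↔
        Nonempty (G.Iso (attach (hypercycle g hk) c (hyperpath hk s) 0))) := by
  obtain ⟨W, hW, T, r, hu, hT, ⟨φ⟩⟩ := h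
  have := Fintype.ofFinite W
  exact ⟨_, minimal_of_iso_attach hk hg hT hu φ⟩

/-- The inner vertex lies only in the first edge, which also contains the cut vertex; the latter
lies in the last edge as well. A hyperpath of positive length is needed to distinguish the two
positions. -/
theorem rho_lollipop₂_lt_lollipop₁ (hk : 3 ≤ k) (hg : 2 ≤ g) {s : ℕ} (hs : 1 ≤ s) :
    (lollipop₂ hk hg s).rho < (lollipop₁ hk hg s).rho := by
  obtain ⟨m, hm, hkm⟩ : ∃ m, 2 ≤ m ∧ k = m + 1 := ⟨k - 1, by omega, by omega⟩
  have hg0 : 0 < g := by omega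
  refine rho_attach_lt_rho_attach (m := m) (by omega) (hkm ▸ hypercycle_isUniform hk hg)
    (hkm ▸ hyperpath_isUniform hk s) ((hypercycle_edgeConnected hk).attach
      (hyperpath_edgeConnected hk s)) ?_ ?_ ?_
  · intro e he hae
    rw [edges_hypercycle, Finset.mem_image] at he
    obtain ⟨i, -, rfl⟩ := he
    rw [mem_hypercycleEdge] at hae ⊢
    simp only [cycleInnerVertex, cycleVertex] at hae ⊢
    rcases hae with h | h
    · exact Or.inl h
    · omega
  · -- the last edge of the hypercycle
    set i : Fin g := ⟨g - 1, by omega⟩ with hi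
    have hsucc : cyclicSucc i = ⟨0, hg0⟩ := by
      ext
      simp only [cyclicSucc, hi]
      rw [Nat.sub_add_cancel (by omega), Nat.mod_self]
    refine ⟨hypercycleEdge g k i, ?_, ?_, ?_⟩
    · rw [edges_hypercycle]; exact Finset.mem_image_of_mem _ (Finset.mem_univ i)
    · exact mem_hypercycleEdge.2 (Or.inr ⟨hsucc.symm, rfl⟩)
    · rw [mem_hypercycleEdge]
      simp only [cycleInnerVertex, hi, Fin.mk.injEq]
      omega
  · refine ⟨hyperpathEdge k s 0, ?_, ?_⟩
    · rw [edges_hyperpath]; exact Finset.mem_image_of_mem _ (Finset.mem_range.2 hs)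
    · simp [hyperpathEdge]

theorem IsOctopuslike.minimal [Fintype V] {G : SimpleHypergraph V} (hk : 3 ≤ k) (hg : 2 ≤ g)
    (h : G.IsOctopuslike hk g) :
    ∃ s : ℕ, (s : ℚ) = (Fintype.card V : ℚ) / ((k : ℚ) - 1) - (g : ℚ) ∧
      (lollipop₂ hk hg s).rho ≤ G.rho ∧
      ((lollipop₂ hk hg s).rho = G.rho ↔ Nonempty (G.Iso (lollipop₂ hk hg s))) := by
  obtain ⟨c, W, hW, T, r, hu, hT, ⟨φ⟩⟩ := h
  have := Fintype.ofFinite W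
  obtain ⟨θ, hθ⟩ := exists_hypercycle_iso hk hg c
  rcases hθ with hθ | hθ
  · obtain ⟨θ'⟩ := nonempty_iso_attach θ (Iso.refl T) (r := r) (r' := r) hθ rfl
    -- Without edges in `T` the position is immaterial, and the identity map moves it to the inner
    -- vertex. With at least one edge, the strict comparison of lollipops makes equality impossible.
    rcases Nat.eq_zero_or_pos T.edges.card with h0 | h0
    · have hE : T.edgeSet = ∅ := by
        rw [Finset.card_eq_zero] at h0
        refine Set.eq_empty_of_forall_notMem fun e he => ?_
        have : e.toFinite.toFinset ∈ T.edges := by rw [mem_edges]; simpa using he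
        rw [h0] at this
        exact absurd this (Finset.notMem_empty _)
      refine IsOctopuslikeAt.minimal hk hg ⟨W, hW, T, r, hu, hT, ⟨(φ.trans θ').trans
        (Iso.ofImage (Equiv.refl _) ?_)⟩⟩
      simp only [Equiv.coe_refl, Set.image_id, Set.image_id']
      simp [attach, hE]
    · obtain ⟨h1, h2, -⟩ := minimal_of_iso_attach hk hg hT hu (φ.trans θ')
      have hlt := (rho_lollipop₂_lt_lollipop₁ hk hg h0).trans_le h2
      exact ⟨_, h1, hlt.le, fun h => absurd h hlt.ne, fun ⟨ψ⟩ => absurd ψ.rho_eq.symm hlt.ne⟩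
  · obtain ⟨θ'⟩ := nonempty_iso_attach θ (Iso.refl T) (r := r) (r' := r) hθ rfl
    exact IsOctopuslikeAt.minimal hk hg ⟨W, hW, T, r, hu, hT, ⟨φ.trans θ'⟩⟩

end SimpleHypergraph

theorem theorem1p4 {V : Type*} [Fintype V] (G : SimpleHypergraph V) (n k g : ℕ)
    (hk : 3 ≤ k) (hg : 2 ≤ g) (hn : Fintype.card V = n) :
    (G.IsOctopuslike hk g →
      ∃ s : ℕ, (s : ℚ) = (n : ℚ) / ((k : ℚ) - 1) - (g : ℚ) ∧
        (SimpleHypergraph.lollipop₂ hk hg s).rho ≤ G.rho ∧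
        ((SimpleHypergraph.lollipop₂ hk hg s).rho = G.rho ↔
          Nonempty (G.Iso (SimpleHypergraph.lollipop₂ hk hg s)))) ∧
    (G.IsOctopuslikeAt hk (SimpleHypergraph.cycleVertex hk hg) →
      ∃ s : ℕ, (s : ℚ) = (n : ℚ) / ((k : ℚ) - 1) - (g : ℚ) ∧
        (SimpleHypergraph.lollipop₁ hk hg s).rho ≤ G.rho ∧
        ((SimpleHypergraph.lollipop₁ hk hg s).rho = G.rho ↔
          Nonempty (G.Iso (SimpleHypergraph.lollipop₁ hk hg s)))) ∧
    (G.IsOctopuslikeAt hk (SimpleHypergraph.cycleInnerVertex hk hg) →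
      ∃ s : ℕ, (s : ℚ) = (n : ℚ) / ((k : ℚ) - 1) - (g : ℚ) ∧
        (SimpleHypergraph.lollipop₂ hk hg s).rho ≤ G.rho ∧
        ((SimpleHypergraph.lollipop₂ hk hg s).rho = G.rho ↔
          Nonempty (G.Iso (SimpleHypergraph.lollipop₂ hk hg s)))) := by
  subst hn
  exact ⟨fun h => h.minimal hk hg, fun h => h.minimal hk hg, fun h => h.minimal hk hg⟩
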